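/- **Setting.** Let $(\eta_t)_{t\in\mathbb Z}$ be i.i.d. real random variables with $E[\eta_t]=0$, $E[\eta_t^2]=\nu^2>0$ and $E[\eta_t^4]<\infty$. Let $(\varepsilon_t)_{t\in\mathbb Z}$ be a causal AR($p$) process with parameter vector $\mathbf a=(a_1,\dots,a_p)^\top$ and innovations $\eta_t$. That is, for every $t$, almost surely $\varepsilon_t=\sum_{j=1}^p a_j\varepsilon_{t-j}+\eta_t$ and $\varepsilon_t=\sum_{k=0}^\infty\psi_k\eta_{t-k}$ for some real $\psi_k$ with $\sum_k|\psi_k|<\infty$. Let $m$ be Lipschitz continuous on $[0,1]$ and let $Y_{t,T}=m(t/T)+\varepsilon_t$. Write $\Delta_\ell Z_t=Z_t-Z_{t-\ell}$. **Estimators.** For $\ell\ge0$ put $$\widehat\gamma_q(\ell)=\frac1{T-q}\sum_{t=q+\ell+1}^T\Delta_qY_{t,T}\,\Delta_qY_{t-\ell,T},$$ and let $\widehat{\boldsymbol\Gamma}_q=(\widehat\gamma_q(|i-j|))_{1\le i,j\le p}$ and $\widehat{\boldsymbol\gamma}_q=(\widehat\gamma_q(1),\dots,\widehat\gamma_q(p))^\top$.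 For $\mathbf b\in\mathbb R^p$ define $c_0(\mathbf b)=1$, $c_k(\mathbf b)=0$ for $k<0$, and $c_k(\mathbf b)=\sum_{j=1}^p b_jc_{k-j}(\mathbf b)$ for $k\ge1$. Put $\mathbf c_r(\mathbf b)=(c_{r-1}(\mathbf b),\dots,c_{r-p}(\mathbf b))^\top$ and $$\nu_T^2(\mathbf b)=\frac1{2T}\sum_{t=s}^T\Big(\Delta_1Y_{t,T}-\sum_{j=1}^pb_j\Delta_1Y_{t-j,T}\Big)^2,$$ where either $s=p+1$ (so that the first summand also involves $Y_{0,T}=m(0)+\varepsilon_0$) or $s=p+2$ (so that only $Y_{1,T},\dots,Y_{T,T}$ are used). The pilot estimator is $$\widetilde{\mathbf a}_q=\widehat{\boldsymbol\Gamma}_q^{-1}\widehat{\boldsymbol\gamma}_q .$$ For a fixed integer $\overline r\ge1$, the refined estimator is $$\widehat{\mathbf a}=\frac1{\overline r}\sum_{r=1}^{\overline r}\widehat{\mathbf a}_r,\qquad \widehat{\mathbf a}_r=\widehat{\boldsymbol\Gamma}_r^{-1}\big(\widehat{\boldsymbol\gamma}_r+\nu_T^2(\widetilde{\mathbf a}_q)\,\mathbf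 c_r(\widetilde{\mathbf a}_q)\big),$$ and the long-run variance estimator is $$\widehat\sigma^2=\frac{\nu_T^2(\widehat{\mathbf a})}{\big(1-\sum_{j=1}^p\widehat a_j\big)^2}.$$ (An inverse of a singular matrix and a quotient by zero are read as zero.) **Proposition 4.1.** Let $q=q_T\to\infty$ with $q_T/\log T\to\infty$ and $q_T/\sqrt T\to0$ as $T\to\infty$. Then the series $\sigma^2=\sum_{\ell=-\infty}^\infty\operatorname{Cov}(\varepsilon_0,\varepsilon_\ell)$ converges absolutely, and $$\widetilde{\mathbf a}_q-\mathbf a=O_p(T^{-1/2}),\qquad \widehat{\mathbf a}-\mathbf a=O_p(T^{-1/2}),\qquad \widehat\sigma^2-\sigma^2=O_p(T^{-1/2}).$$ Here $X_T=O_p(T^{-1/2})$ means that for every $\delta>0$ there is $M>0$ such that $P(\|X_T\|>MT^{-1/2})\le\delta$ for all sufficiently large $T$. -/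

import Mathlib

open MeasureTheory ProbabilityTheory Filter Topology

namespace DiffLRV

/-- The `l`-th difference `Δ_l z_t = z_t - z_{t-l}` of a time series. -/
def diff (l : ℕ) (z : ℤ → ℝ) (t : ℤ) : ℝ := z t - z (t - l)

/-- Sample autocovariance of the `q`-th differences at lag `l ≥ 0`, from the data `y 1, …, y T`:
`(T - q)⁻¹ ∑_{t = q + l + 1}^T Δ_q y_t Δ_q y_{t-l}`. -/
noncomputable def sampleAutocov (y : ℤ → ℝ) (T q l : ℕ) : ℝ :=
  ((T : ℝ) - (q : ℝ))⁻¹ *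
    ∑ t ∈ Finset.Icc ((q : ℤ) + (l : ℤ) + 1) (T : ℤ), diff q y t * diff q y (t - l)

/-- The `p × p` matrix of the sample autocovariances at the lags `|i - j|`. -/
noncomputable def sampleMatrix (p : ℕ) (y : ℤ → ℝ) (T q : ℕ) : Matrix (Fin p) (Fin p) ℝ :=
  Matrix.of fun i j => sampleAutocov y T q ((i : ℤ) - (j : ℤ)).natAbs

/-- The vector of the sample autocovariances at the lags `1, …, p`
(entry `i : Fin p` is the one of lag `i + 1`). -/
noncomputable def sampleVector (p : ℕ) (y : ℤ → ℝ) (T q : ℕ) : Fin p → ℝ :=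
  fun i => sampleAutocov y T q ((i : ℕ) + 1)

/-- The MA(∞) coefficients belonging to AR parameters `a` (where `a j`, `j : Fin p`, is the
parameter of lag `j + 1`): `c_0 = 1` and `c_k = ∑_{j=1}^p a_j c_{k-j}` for `k ≥ 1`,
where `c_k = 0` for `k < 0`. -/
noncomputable def maCoeff {p : ℕ} (a : Fin p → ℝ) : ℕ → ℝ
  | 0 => 1
  | k + 1 => ∑ j : Fin p, if (j : ℕ) ≤ k then a j * maCoeff a (k - (j : ℕ)) else 0

/-- The vector `(c_{r-1}, …, c_{r-p})`, with `c_k = 0` for `k < 0`. -/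
noncomputable def maVector {p : ℕ} (a : Fin p → ℝ) (r : ℕ) : Fin p → ℝ :=
  fun i => if (i : ℕ) + 1 ≤ r then maCoeff a (r - ((i : ℕ) + 1)) else 0

/-- The pilot estimator `Γ̂_q⁻¹ γ̂_q`. -/
noncomputable def pilotEst (p : ℕ) (y : ℤ → ℝ) (T q : ℕ) : Fin p → ℝ :=
  (sampleMatrix p y T q)⁻¹.mulVec (sampleVector p y T q)

/-- Residuals of the first differences for AR parameters `b`:
`Δ_1 y_t - ∑_{j=1}^p b_j Δ_1 y_{t-j}`. -/
noncomputable def residual {p : ℕ} (b : Fin p → ℝ) (y : ℤ → ℝ) (t : ℤ) : ℝ :=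
  diff 1 y t - ∑ j : Fin p, b j * diff 1 y (t - ((j : ℤ) + 1))

/-- Innovation variance estimated with AR parameters `b`:
`(2T)⁻¹ ∑_{t = s}^T (residual_t)²`, where `s` is the first time point used. -/
noncomputable def innovVarEst {p : ℕ} (s : ℕ) (b : Fin p → ℝ) (y : ℤ → ℝ) (T : ℕ) : ℝ :=
  (2 * (T : ℝ))⁻¹ * ∑ t ∈ Finset.Icc (s : ℤ) (T : ℤ), residual b y t ^ 2

/-- The second-stage estimator `Γ̂_r⁻¹ (γ̂_r + ν̃² c̃_r)`, where `ν̃²` and `c̃_r` are computed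
from the pilot estimator with differencing order `q`. -/
noncomputable def secondStageEst (p s : ℕ) (y : ℤ → ℝ) (T q r : ℕ) : Fin p → ℝ :=
  (sampleMatrix p y T r)⁻¹.mulVec
    (sampleVector p y T r +
      innovVarEst s (pilotEst p y T q) y T • maVector (pilotEst p y T q) r)

/-- The refined estimator: the average of the second-stage estimators over `r = 1, …, R`. -/
noncomputable def refinedEst (p s : ℕ) (y : ℤ → ℝ) (T q R : ℕ) : Fin p → ℝ :=
  (R : ℝ)⁻¹ • ∑ r ∈ Finset.Icc 1 R, secondStageEst p s y T q r

/-- The long-run variance estimator `ν̂² / (1 - ∑ â_j)²`. -/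
noncomputable def lrvEst (p s : ℕ) (y : ℤ → ℝ) (T q R : ℕ) : ℝ :=
  innovVarEst s (refinedEst p s y T q R) y T / (1 - ∑ j : Fin p, refinedEst p s y T q R j) ^ 2

/-- The nonparametric trend model `Y_{t,T} = m(t/T) + ε_t`. -/
noncomputable def obs {Ω : Type*} (m : ℝ → ℝ) (ε : ℤ → Ω → ℝ) (T : ℕ) (ω : Ω) (t : ℤ) : ℝ :=
  m ((t : ℝ) / (T : ℝ)) + ε t ω

/-- I.i.d. innovations with mean zero and second moment `ν²`. -/
structure IsIIDNoise {Ω : Type*} [MeasurableSpace Ω] (P : Measure Ω) (ν : ℝ)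
    (η : ℤ → Ω → ℝ) : Prop where
  measurable : ∀ t, Measurable (η t)
  indep : iIndepFun η P
  identDistrib : ∀ t, IdentDistrib (η t) (η 0) P P
  mean_zero : ∀ t, ∫ ω, η t ω ∂P = 0
  second_moment : ∀ t, ∫ ω, η t ω ^ 2 ∂P = ν ^ 2

/-- `ε` is a causal AR(p) process with parameters `a` (`a j`, `j : Fin p`, is the parameter of
lag `j + 1`) and innovations `η`: it solves the AR equation and is, for some absolutely summable
`ψ`, the one-sided moving average `ε_t = ∑_{k ≥ 0} ψ_k η_{t-k}`. For i.i.d. innovations such a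
moving average is stationary. -/
structure IsCausalAR {Ω : Type*} [MeasurableSpace Ω] (P : Measure Ω) {p : ℕ} (a : Fin p → ℝ)
    (η ε : ℤ → Ω → ℝ) : Prop where
  measurable : ∀ t, Measurable (ε t)
  ar_eq : ∀ t : ℤ, ∀ᵐ ω ∂P, ε t ω = ∑ j : Fin p, a j * ε (t - ((j : ℤ) + 1)) ω + η t ω
  causal : ∃ ψ : ℕ → ℝ, Summable (fun k => |ψ k|) ∧
    ∀ t : ℤ, ∀ᵐ ω ∂P, HasSum (fun k : ℕ => ψ k * η (t - (k : ℤ)) ω) (ε t ω)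

/-- `X_T = O_p(ρ_T)` as `T → ∞`. -/
def IsBigOp {Ω E : Type*} [MeasurableSpace Ω] [Norm E] (P : Measure Ω) (X : ℕ → Ω → E)
    (ρ : ℕ → ℝ) : Prop :=
  ∀ δ : ℝ, 0 < δ → ∃ M : ℝ, 0 < M ∧
    ∀ᶠ T in atTop, P {ω | M * ρ T < ‖X T ω‖} ≤ ENNReal.ofReal δ

/-- The long-run variance `∑_{l ∈ ℤ} Cov(ε_0, ε_l)`. -/
noncomputable def longRunVar {Ω : Type*} [MeasurableSpace Ω] (P : Measure Ω)
    (ε : ℤ → Ω → ℝ) : ℝ :=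
  ∑' l : ℤ, cov[ε 0, ε l; P]

end DiffLRV

/-!
All estimators are rational functions of finitely many sample second moments of differenced data,
so that `√T`-consistency of these moments suffices: `RootConsistent` is stable under the field
operations by the delta method (`IsBigOp.comp_sub`), hence under inversion of a regular matrix
(`RootConsistent.inv_mulVec`).

For the sample moments, the trend contributes to the `q`-th differences only terms of the order
`q / T = o(T^{-1/2})`, which are bounded in `L¹`. For the noise, a bound is needed that is uniform
in the lag, as the lag grows with `q_T`. Shifts of a product of two innovations are uncorrelated
after centring (`IsIIDNoise.integral_centredProduct_mul`), so a sum of `n` of them has `L²` norm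
`O(√n)`; Minkowski's inequality over the absolutely summable moving average coefficients, and
Fatou's lemma for their truncation, give the same for products of the linear process
(`eLpNorm_sum_mul_sub_le`). Together these yield `isBigOp_sum_diff_mul`.

The limits are identified in the Hilbert space `L²`, where a causal AR process is a moving average
of orthogonal vectors (`IsHilbertAR`). Inner products of the AR equation with the noise show that
the moving average coefficients are the impulse responses `maCoeff a`; inner products with the
past of the process give the Yule-Walker equations, which for `r`-th differences have the extra
term `ν² c_r` (`IsHilbertAR.yule_walker_diff`). The limiting matrices are Gram matrices with a
triangular array of inner products with the noise, hence regular (`gram_det_ne_zero`).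

For the pilot estimator the autocovariances of the differences, `2 γ(l) - γ(l + q) - γ(l - q)`,
have to approach `2 γ(l)` at the rate `T^{-1/2}`. As `q_T / log T → ∞`, this follows from the
geometric decay of the impulse responses. It is deduced from their absolute summability by a
perturbation argument for formal power series (`exists_maCoeff_le_geometric`), without reference
to the roots of the AR polynomial. The long-run variance is `ν² (∑ ψ)²`, and summing the recursion
of the impulse responses gives `(∑ ψ) (1 - ∑ a) = 1`, so that the denominator does not vanish.
-/

namespace DiffLRV

/-! ### Orders in probability -/

section BigOp

variable {Ω E F : Type*} [MeasurableSpace Ω] {P : Measure Ω}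

theorem IsBigOp.congr' [Norm E] {X Y : ℕ → Ω → E} {ρ : ℕ → ℝ} (h : IsBigOp P X ρ)
    (hXY : ∀ᶠ T in atTop, X T = Y T) : IsBigOp P Y ρ := by
  intro δ hδ
  obtain ⟨M, hM, h⟩ := h δ hδ
  refine ⟨M, hM, ?_⟩
  filter_upwards [h, hXY] with T h1 h2
  rwa [← h2]

theorem IsBigOp.add [SeminormedAddCommGroup E] {X Y : ℕ → Ω → E} {ρ : ℕ → ℝ}
    (hX : IsBigOp P X ρ) (hY : IsBigOp P Y ρ) :
    IsBigOp P (fun T ω => X T ω + Y T ω) ρ := by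
  intro δ hδ
  obtain ⟨M, hM, h⟩ := hX (δ / 2) (by positivity)
  obtain ⟨N, hN, h'⟩ := hY (δ / 2) (by positivity)
  refine ⟨M + N, by positivity, ?_⟩
  filter_upwards [h, h'] with T h1 h2
  have hsub : {ω | (M + N) * ρ T < ‖X T ω + Y T ω‖} ⊆
      {ω | M * ρ T < ‖X T ω‖} ∪ {ω | N * ρ T < ‖Y T ω‖} := by
    intro ω hω
    simp only [Set.mem_ofPred_eq, Set.mem_union] at hω ⊢
    by_contra! hcon
    have := norm_add_le (X T ω) (Y T ω)
    nlinarith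
  calc P {ω | (M + N) * ρ T < ‖X T ω + Y T ω‖}
      ≤ P {ω | M * ρ T < ‖X T ω‖} + P {ω | N * ρ T < ‖Y T ω‖} :=
        (measure_mono hsub).trans (measure_union_le _ _)
    _ ≤ ENNReal.ofReal (δ / 2) + ENNReal.ofReal (δ / 2) := add_le_add h1 h2
    _ = ENNReal.ofReal δ := by
        rw [← ENNReal.ofReal_add (by positivity) (by positivity), add_halves]

/-- A deterministic sequence of order `ρ` is of order `ρ` in probability. -/
theorem IsBigOp.of_eventually_le [Norm E] {x : ℕ → E} {ρ : ℕ → ℝ} {K : ℝ}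
    (hρ : ∀ᶠ T in atTop, 0 ≤ ρ T) (h : ∀ᶠ T in atTop, ‖x T‖ ≤ K * ρ T) :
    IsBigOp P (fun T _ => x T) ρ := by
  intro δ hδ
  refine ⟨max K 1, by positivity, ?_⟩
  filter_upwards [hρ, h] with T h0 h1
  have : {ω : Ω | max K 1 * ρ T < ‖x T‖} = ∅ := by
    ext ω
    simp only [Set.mem_ofPred_eq, Set.mem_empty_iff_false, iff_false, not_lt]
    exact h1.trans (mul_le_mul_of_nonneg_right (le_max_left _ _) h0)
  simp [this]

/-- Markov's inequality: a sequence of order `ρ` in `L¹` is of order `ρ` in probability. -/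
theorem IsBigOp.of_eLpNorm_le [NormedAddCommGroup E] {X : ℕ → Ω → E} {ρ : ℕ → ℝ} {K : ℝ}
    (hρ : ∀ᶠ T in atTop, 0 < ρ T) (hX : ∀ T, AEStronglyMeasurable (X T) P)
    (h : ∀ᶠ T in atTop, eLpNorm (X T) 1 P ≤ ENNReal.ofReal (K * ρ T)) :
    IsBigOp P X ρ := by
  intro δ hδ
  have hK : (0 : ℝ) < max K 1 := by positivity
  refine ⟨max K 1 / δ, by positivity, ?_⟩
  filter_upwards [hρ, h] with T h0 h1
  have hM : 0 < max K 1 / δ * ρ T := by positivity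
  have hsub : {ω | max K 1 / δ * ρ T < ‖X T ω‖} ⊆
      {ω | ENNReal.ofReal (max K 1 / δ * ρ T) ≤ ‖X T ω‖ₑ} := by
    intro ω hω
    simp only [Set.mem_ofPred_eq] at hω ⊢
    rw [← ofReal_norm]
    exact ENNReal.ofReal_le_ofReal hω.le
  refine (measure_mono hsub).trans ?_
  have hmarkov := mul_meas_ge_le_lintegral₀ (μ := P) (hX T).enorm
    (ENNReal.ofReal (max K 1 / δ * ρ T))
  rw [← eLpNorm_one_eq_lintegral_enorm] at hmarkov
  have h2 : ENNReal.ofReal (K * ρ T) ≤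
      ENNReal.ofReal (max K 1 / δ * ρ T) * ENNReal.ofReal δ := by
    rw [← ENNReal.ofReal_mul hM.le]
    apply ENNReal.ofReal_le_ofReal
    have : max K 1 / δ * ρ T * δ = max K 1 * ρ T := by field_simp
    rw [this]
    exact mul_le_mul_of_nonneg_right (le_max_left _ _) h0.le
  have h3 := hmarkov.trans (h1.trans h2)
  rwa [ENNReal.mul_le_mul_iff_right (by simpa using hM) ENNReal.ofReal_ne_top] at h3

/-- Delta method: a function with a linear modulus of continuity at `x` keeps the rate of a
sequence of random variables close to `x`. -/
theorem IsBigOp.comp_sub [SeminormedAddCommGroup E] [SeminormedAddCommGroup F]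
    {X : ℕ → Ω → E} {x : E} {ρ : ℕ → ℝ} {f : E → F} (hρ : Tendsto ρ atTop (𝓝 0))
    (hf : (fun y => f y - f x) =O[𝓝 x] fun y => y - x)
    (hX : IsBigOp P (fun T ω => X T ω - x) ρ) :
    IsBigOp P (fun T ω => f (X T ω) - f x) ρ := by
  intro δ hδ
  obtain ⟨M, hM, h⟩ := hX δ hδ
  obtain ⟨C, hC, hf⟩ := hf.exists_pos
  rw [Asymptotics.isBigOWith_iff, Metric.eventually_nhds_iff] at hf
  obtain ⟨e, he, hf⟩ := hf
  refine ⟨C * M, by positivity, ?_⟩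
  have hsmall : ∀ᶠ T in atTop, M * ρ T < e := by
    have : Tendsto (fun T => M * ρ T) atTop (𝓝 0) := by simpa using hρ.const_mul M
    exact this.eventually (gt_mem_nhds he)
  filter_upwards [h, hsmall] with T h1 h2
  refine (measure_mono ?_).trans h1
  intro ω hω
  simp only [Set.mem_ofPred_eq] at hω ⊢
  by_contra! hcon
  have h3 := hf (y := X T ω) (by rw [dist_eq_norm]; exact hcon.trans_lt h2)
  have : C * ‖X T ω - x‖ ≤ C * (M * ρ T) := mul_le_mul_of_nonneg_left hcon hC.le
  nlinarith

theorem IsBigOp.prodMk [SeminormedAddCommGroup E] [SeminormedAddCommGroup F]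
    {X : ℕ → Ω → E} {Y : ℕ → Ω → F} {ρ : ℕ → ℝ}
    (hX : IsBigOp P X ρ) (hY : IsBigOp P Y ρ) :
    IsBigOp P (fun T ω => (X T ω, Y T ω)) ρ := by
  have h1 : IsBigOp P (fun T ω => (X T ω, (0 : F))) ρ := by
    simpa only [IsBigOp, Prod.norm_mk, norm_zero, norm_nonneg, max_eq_left] using hX
  have h2 : IsBigOp P (fun T ω => ((0 : E), Y T ω)) ρ := by
    simpa only [IsBigOp, Prod.norm_mk, norm_zero, norm_nonneg, max_eq_right] using hY
  simpa using h1.add h2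

end BigOp

/-! ### Root-`T` consistent estimators -/

section RootConsistent

variable {Ω E F ι : Type*} [MeasurableSpace Ω] {P : Measure Ω}

/-- `X_T` is a `√T`-consistent estimator of `x`: `X_T - x = O_p(T^{-1/2})`. -/
def RootConsistent [SeminormedAddCommGroup E] (P : Measure Ω) (X : ℕ → Ω → E) (x : E) : Prop :=
  IsBigOp P (fun T ω => X T ω - x) (fun T => 1 / √(T : ℝ))

theorem tendsto_one_div_sqrt_nat : Tendsto (fun T : ℕ => 1 / √(T : ℝ)) atTop (𝓝 0) := by
  simp only [one_div]
  exact tendsto_inv_atTop_zero.comp (Real.tendsto_sqrt_atTop.comp tendsto_natCast_atTop_atTop)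

theorem eventually_one_div_sqrt_nat_pos : ∀ᶠ T : ℕ in atTop, 0 < 1 / √(T : ℝ) := by
  filter_upwards [eventually_gt_atTop 0] with T hT
  have : (0 : ℝ) < T := by exact_mod_cast hT
  positivity

namespace RootConsistent

theorem const [SeminormedAddCommGroup E] (x : E) : RootConsistent P (fun _ _ => x) x := by
  have := IsBigOp.of_eventually_le (P := P) (x := fun _ : ℕ => (0 : E)) (K := 1)
    (ρ := fun T : ℕ => 1 / √(T : ℝ)) (.of_forall fun T => by positivity)
    (.of_forall fun T => by simp)
  simpa only [RootConsistent, sub_self] using this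

theorem congr' [SeminormedAddCommGroup E] {X Y : ℕ → Ω → E} {x : E} (h : RootConsistent P X x)
    (hXY : ∀ᶠ T in atTop, X T = Y T) : RootConsistent P Y x :=
  IsBigOp.congr' h (hXY.mono fun T hT => by rw [hT])

theorem comp_differentiableAt [NormedAddCommGroup E] [NormedSpace ℝ E] [NormedAddCommGroup F]
    [NormedSpace ℝ F] {X : ℕ → Ω → E} {x : E} {f : E → F} (h : RootConsistent P X x)
    (hf : DifferentiableAt ℝ f x) : RootConsistent P (fun T ω => f (X T ω)) (f x) :=
  IsBigOp.comp_sub tendsto_one_div_sqrt_nat hf.isBigO_sub h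

theorem prodMk [SeminormedAddCommGroup E] [SeminormedAddCommGroup F] {X : ℕ → Ω → E}
    {Y : ℕ → Ω → F} {x : E} {y : F} (hX : RootConsistent P X x) (hY : RootConsistent P Y y) :
    RootConsistent P (fun T ω => (X T ω, Y T ω)) (x, y) :=
  IsBigOp.prodMk hX hY

variable {X Y : ℕ → Ω → ℝ} {x y : ℝ}

theorem add (hX : RootConsistent P X x) (hY : RootConsistent P Y y) :
    RootConsistent P (fun T ω => X T ω + Y T ω) (x + y) :=
  (hX.prodMk hY).comp_differentiableAt (f := fun z : ℝ × ℝ => z.1 + z.2) (by fun_prop)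

theorem sub (hX : RootConsistent P X x) (hY : RootConsistent P Y y) :
    RootConsistent P (fun T ω => X T ω - Y T ω) (x - y) :=
  (hX.prodMk hY).comp_differentiableAt (f := fun z : ℝ × ℝ => z.1 - z.2) (by fun_prop)

theorem mul (hX : RootConsistent P X x) (hY : RootConsistent P Y y) :
    RootConsistent P (fun T ω => X T ω * Y T ω) (x * y) :=
  (hX.prodMk hY).comp_differentiableAt (f := fun z : ℝ × ℝ => z.1 * z.2) (by fun_prop)

theorem const_mul (c : ℝ) (hX : RootConsistent P X x) :
    RootConsistent P (fun T ω => c * X T ω) (c * x) :=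
  (const c).mul hX

theorem pow (hX : RootConsistent P X x) (n : ℕ) :
    RootConsistent P (fun T ω => X T ω ^ n) (x ^ n) :=
  hX.comp_differentiableAt (f := fun z : ℝ => z ^ n) (by fun_prop)

theorem inv (hX : RootConsistent P X x) (hx : x ≠ 0) :
    RootConsistent P (fun T ω => (X T ω)⁻¹) x⁻¹ :=
  hX.comp_differentiableAt (f := fun z : ℝ => z⁻¹) (differentiableAt_inv hx)

theorem sum {X : ι → ℕ → Ω → ℝ} {x : ι → ℝ} (s : Finset ι)
    (h : ∀ i ∈ s, RootConsistent P (X i) (x i)) :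
    RootConsistent P (fun T ω => ∑ i ∈ s, X i T ω) (∑ i ∈ s, x i) := by
  classical
  induction s using Finset.induction_on with
  | empty => simpa using const (P := P) (0 : ℝ)
  | insert i s hi ih =>
    simp only [Finset.sum_insert hi]
    exact (h i (Finset.mem_insert_self i s)).add
      (ih fun j hj => h j (Finset.mem_insert_of_mem hj))

theorem prod {X : ι → ℕ → Ω → ℝ} {x : ι → ℝ} (s : Finset ι)
    (h : ∀ i ∈ s, RootConsistent P (X i) (x i)) :
    RootConsistent P (fun T ω => ∏ i ∈ s, X i T ω) (∏ i ∈ s, x i) := by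
  classical
  induction s using Finset.induction_on with
  | empty => simpa using const (P := P) (1 : ℝ)
  | insert i s hi ih =>
    simp only [Finset.prod_insert hi]
    exact (h i (Finset.mem_insert_self i s)).mul
      (ih fun j hj => h j (Finset.mem_insert_of_mem hj))

variable [Fintype ι] [DecidableEq ι]

theorem det {A : ℕ → Ω → Matrix ι ι ℝ} {A₀ : Matrix ι ι ℝ}
    (h : ∀ i j, RootConsistent P (fun T ω => A T ω i j) (A₀ i j)) :
    RootConsistent P (fun T ω => (A T ω).det) A₀.det := by
  simp only [Matrix.det_apply']
  exact sum _ fun σ _ => (prod _ fun i _ => h (σ i) i).const_mul _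

theorem inv_apply {A : ℕ → Ω → Matrix ι ι ℝ} {A₀ : Matrix ι ι ℝ}
    (h : ∀ i j, RootConsistent P (fun T ω => A T ω i j) (A₀ i j)) (h₀ : A₀.det ≠ 0) (i j : ι) :
    RootConsistent P (fun T ω => (A T ω)⁻¹ i j) (A₀⁻¹ i j) := by
  simp only [Matrix.inv_def, Ring.inverse_eq_inv', Matrix.smul_apply, smul_eq_mul,
    Matrix.adjugate_apply]
  refine ((det h).inv h₀).mul (det fun k l => ?_)
  simp only [Matrix.updateRow_apply]
  split_ifs
  · exact const _
  · exact h k l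

theorem pi {X : ℕ → Ω → ι → ℝ} {x : ι → ℝ}
    (h : ∀ i, RootConsistent P (fun T ω => X T ω i) (x i)) : RootConsistent P X x := by
  have key : ∀ s : Finset ι, IsBigOp P (fun T ω => ∑ i ∈ s, Pi.single i (X T ω i - x i))
      (fun T => 1 / √(T : ℝ)) := by
    intro s
    induction s using Finset.induction_on with
    | empty =>
      simpa [RootConsistent] using const (P := P) (0 : ι → ℝ)
    | insert i s hi ih =>
      simp only [Finset.sum_insert hi]
      refine IsBigOp.add ?_ ih
      simpa only [IsBigOp, Pi.norm_single, RootConsistent] using h i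
  refine IsBigOp.congr' (key Finset.univ) (.of_forall fun T => ?_)
  funext ω
  exact Finset.univ_sum_single (X T ω - x)

omit [DecidableEq ι] in
theorem apply {X : ℕ → Ω → ι → ℝ} {x : ι → ℝ} (h : RootConsistent P X x) (i : ι) :
    RootConsistent P (fun T ω => X T ω i) (x i) :=
  h.comp_differentiableAt (f := fun z : ι → ℝ => z i) (by fun_prop)

/-- The solution of a consistently estimated regular linear system is consistent. -/
theorem inv_mulVec {A : ℕ → Ω → Matrix ι ι ℝ} {A₀ : Matrix ι ι ℝ} {v : ℕ → Ω → ι → ℝ}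
    {v₀ a : ι → ℝ} (h : ∀ i j, RootConsistent P (fun T ω => A T ω i j) (A₀ i j))
    (hv : ∀ i, RootConsistent P (fun T ω => v T ω i) (v₀ i)) (h₀ : A₀.det ≠ 0)
    (ha : A₀.mulVec a = v₀) : RootConsistent P (fun T ω => (A T ω)⁻¹.mulVec (v T ω)) a := by
  have hsol : A₀⁻¹.mulVec v₀ = a := by
    rw [← ha, Matrix.mulVec_mulVec, Matrix.nonsing_inv_mul _ (isUnit_iff_ne_zero.mpr h₀),
      Matrix.one_mulVec]
  refine pi fun i => ?_
  rw [← hsol]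
  exact sum _ fun j _ => (inv_apply h h₀ i j).mul (hv j)

end RootConsistent

end RootConsistent

/-! ### Geometric decay of impulse responses -/

section Decay

open PowerSeries

variable {p : ℕ} (a : Fin p → ℝ)

/-- The recursion of the impulse responses, as an identity `U = 1 + A U` of formal power series. -/
theorem mk_maCoeff_eq :
    (PowerSeries.mk (maCoeff a)) =
      1 + (∑ j : Fin p, C (a j) * X ^ ((j : ℕ) + 1)) * PowerSeries.mk (maCoeff a) := by
  ext n
  rw [map_add, Finset.sum_mul, map_sum]
  have h : ∀ j : Fin p, coeff n (C (a j) * X ^ ((j : ℕ) + 1) * PowerSeries.mk (maCoeff a)) =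
      if (j : ℕ) + 1 ≤ n then a j * maCoeff a (n - ((j : ℕ) + 1)) else 0 := by
    intro j
    rw [mul_assoc, coeff_C_mul, coeff_X_pow_mul']
    split_ifs <;> simp
  simp only [h, coeff_mk, coeff_one]
  cases n with
  | zero => simp [maCoeff]
  | succ k => simp [maCoeff]

/-- Absolutely summable impulse responses of a finite-order recursion decay geometrically. The
dilated series `D = ∑ θ ^ n c_n z ^ n` satisfies `D = P + P (A_θ - A) D`, where `P = ∑ c_n z ^ n`
has finite `ℓ¹` norm and the polynomial `A_θ - A` is small for `θ` close to `1`. -/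
theorem exists_maCoeff_le_geometric (h : Summable fun k => |maCoeff a k|) :
    ∃ θ : ℝ, 1 < θ ∧ ∃ K : ℝ, 0 ≤ K ∧ ∀ n, |maCoeff a n| ≤ K * θ⁻¹ ^ n := by
  set S : ℝ := ∑' k, |maCoeff a k| with hS
  have hS0 : 0 ≤ S := tsum_nonneg fun _ => abs_nonneg _
  have hle : ∀ n, |maCoeff a n| ≤ S := fun n => h.le_tsum n fun _ _ => abs_nonneg _
  -- the `ℓ¹` norm of `A_θ - A` tends to `0` as `θ` tends to `1`
  obtain ⟨θ, hθ, hθ1⟩ : ∃ θ : ℝ, S * ∑ j : Fin p, |a j| * |θ ^ ((j : ℕ) + 1) - 1| < 1 / 2 ∧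
      1 < θ := by
    have hc : Continuous fun θ : ℝ => S * ∑ j : Fin p, |a j| * |θ ^ ((j : ℕ) + 1) - 1| := by
      fun_prop
    have hev : ∀ᶠ θ in 𝓝 (1 : ℝ),
        S * ∑ j : Fin p, |a j| * |θ ^ ((j : ℕ) + 1) - 1| < 1 / 2 :=
      hc.continuousAt.eventually (gt_mem_nhds (by simp))
    exact ((hev.filter_mono nhdsWithin_le_nhds).and
      (eventually_mem_nhdsWithin (a := (1 : ℝ)) (s := Set.Ioi 1))).exists
  set β : ℝ := ∑ j : Fin p, |a j| * |θ ^ ((j : ℕ) + 1) - 1| with hβ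
  have hβ0 : 0 ≤ β := Finset.sum_nonneg fun j _ => by positivity
  set U : PowerSeries ℝ := PowerSeries.mk (maCoeff a) with hU
  set A : PowerSeries ℝ := ∑ j : Fin p, C (a j) * X ^ ((j : ℕ) + 1) with hA
  set B : PowerSeries ℝ := ∑ j : Fin p, C (a j * (θ ^ ((j : ℕ) + 1) - 1)) * X ^ ((j : ℕ) + 1)
    with hB
  set D : PowerSeries ℝ := rescale θ U with hD
  have hUA : U = 1 + A * U := mk_maCoeff_eq a
  have hresA : rescale θ A = A + B := by
    rw [hA, hB, map_sum, ← Finset.sum_add_distrib]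
    refine Finset.sum_congr rfl fun j _ => ?_
    ext n
    simp only [coeff_rescale, coeff_C_mul, coeff_X_pow, map_add]
    split_ifs with hn
    · subst hn; ring
    · simp
  have hDA : D = 1 + (A + B) * D := by
    have := congrArg (rescale θ) hUA
    rwa [map_add, map_mul, map_one, hresA] at this
  have hfix : D = U + U * (B * D) := by
    linear_combination U * hDA - D * hUA
  have hcoefD : ∀ n, coeff n D = θ ^ n * maCoeff a n := fun n => by
    rw [hD, coeff_rescale, hU, coeff_mk]
  have hcoefBD : ∀ n, ∀ M : ℝ, (∀ m ≤ n, |coeff m D| ≤ M) → |coeff n (B * D)| ≤ β * M := by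
    intro n M hM
    have hM0 : 0 ≤ M := (abs_nonneg _).trans (hM n le_rfl)
    rw [hB, Finset.sum_mul, map_sum, hβ, Finset.sum_mul]
    refine (Finset.abs_sum_le_sum_abs _ _).trans (Finset.sum_le_sum fun j _ => ?_)
    rw [mul_assoc, coeff_C_mul, coeff_X_pow_mul', abs_mul, abs_mul]
    refine mul_le_mul_of_nonneg_left ?_ (by positivity)
    split_ifs
    · exact hM _ (Nat.sub_le _ _)
    · simpa using hM0
  have hcoefUG : ∀ n, ∀ G : PowerSeries ℝ, ∀ M : ℝ, (∀ m ≤ n, |coeff m G| ≤ M) →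
      |coeff n (U * G)| ≤ S * M := by
    intro n G M hM
    have hM0 : 0 ≤ M := (abs_nonneg _).trans (hM n le_rfl)
    rw [coeff_mul]
    calc |∑ x ∈ Finset.HasAntidiagonal.antidiagonal n, coeff x.1 U * coeff x.2 G|
        ≤ ∑ x ∈ Finset.HasAntidiagonal.antidiagonal n, |maCoeff a x.1| * M := by
          refine (Finset.abs_sum_le_sum_abs _ _).trans (Finset.sum_le_sum fun x hx => ?_)
          rw [abs_mul, hU, coeff_mk]
          refine mul_le_mul_of_nonneg_left (hM _ ?_) (abs_nonneg _)
          rw [Finset.HasAntidiagonal.mem_antidiagonal] at hx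
          omega
      _ = (∑ k ∈ Finset.range (n + 1), |maCoeff a k|) * M := by
          rw [← Finset.sum_mul,
            Finset.Nat.sum_antidiagonal_eq_sum_range_succ (fun i _ => |maCoeff a i|)]
      _ ≤ S * M := mul_le_mul_of_nonneg_right
          (h.sum_le_tsum _ fun _ _ => abs_nonneg _) hM0
  have hbound : ∀ N, |coeff N D| ≤ 2 * S := by
    intro N
    -- the fixed point equation, at an index of maximal coefficient among the first `N + 1`
    obtain ⟨n, hn, hmax⟩ := Finset.exists_max_image (Finset.range (N + 1))
      (fun n => |coeff n D|) ⟨0, by simp⟩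
    have hmax' : ∀ m ≤ n, |coeff m D| ≤ |coeff n D| := fun m hm =>
      hmax m (by simp only [Finset.mem_range] at hn ⊢; omega)
    have h1 : |coeff n D| ≤ S + S * (β * |coeff n D|) := by
      conv_lhs => rw [hfix, map_add]
      refine (abs_add_le _ _).trans (add_le_add ?_ ?_)
      · rw [hU, coeff_mk]; exact hle n
      · exact hcoefUG n _ _ fun m hm =>
          hcoefBD m _ fun k hk => hmax' k (hk.trans hm)
    have h2 : |coeff N D| ≤ |coeff n D| := hmax N (by simp)
    nlinarith [abs_nonneg (coeff n D)]
  have hθ0 : 0 < θ := by linarith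
  refine ⟨θ, hθ1, 2 * S, by positivity, fun n => ?_⟩
  have := hbound n
  rw [hcoefD, abs_mul, abs_of_pos (pow_pos hθ0 n)] at this
  rw [inv_pow, ← div_eq_mul_inv, le_div_iff₀ (pow_pos hθ0 n)]
  linarith

end Decay

/-! ### Coefficients and autocovariances of moving averages -/

section LinearProcess

/-- The extension of a one-sided sequence of coefficients by zero to negative indices. -/
noncomputable def zeroExtend (ψ : ℕ → ℝ) (k : ℤ) : ℝ := if 0 ≤ k then ψ k.toNat else 0

/-- The autocovariance at lag `h : ℤ` of the moving average with coefficients `ψ` and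
uncorrelated innovations of variance `ν ^ 2`. -/
noncomputable def maAutocov (ν : ℝ) (ψ : ℕ → ℝ) (h : ℤ) : ℝ :=
  ν ^ 2 * ∑' j : ℕ, ψ j * zeroExtend ψ (j + h)

/-- The autocovariance at lag `h` of the `r`-th differences of a stationary process with
autocovariance function `γ`. -/
def diffAutocov (γ : ℤ → ℝ) (r h : ℤ) : ℝ := 2 * γ h - γ (h + r) - γ (h - r)

theorem zeroExtend_natCast (ψ : ℕ → ℝ) (k : ℕ) : zeroExtend ψ k = ψ k := by
  simp [zeroExtend]

theorem zeroExtend_of_neg (ψ : ℕ → ℝ) {k : ℤ} (hk : k < 0) : zeroExtend ψ k = 0 := by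
  simp [zeroExtend, not_le.mpr hk]

theorem summable_zeroExtend {ψ : ℕ → ℝ} (hψ : Summable ψ) : Summable (zeroExtend ψ) := by
  rw [← Nat.cast_injective.summable_iff (f := zeroExtend ψ) (g := ((↑) : ℕ → ℤ))]
  · simpa only [Function.comp_def, zeroExtend_natCast] using hψ
  · intro k hk
    refine zeroExtend_of_neg ψ ?_
    by_contra! h
    exact hk ⟨k.toNat, by simp [h]⟩

theorem tsum_zeroExtend (ψ : ℕ → ℝ) : ∑' k, zeroExtend ψ k = ∑' k, ψ k := by
  rw [← Nat.cast_injective.tsum_eq (f := zeroExtend ψ) (g := ((↑) : ℕ → ℤ))]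
  · simp only [zeroExtend_natCast]
  · intro k hk
    by_contra h
    refine hk (zeroExtend_of_neg ψ ?_)
    by_contra! h0
    exact h ⟨k.toNat, by simp [h0]⟩

/-- Summing the AR recursion over all lags determines the sum of the impulse responses. -/
theorem tsum_mul_one_sub_sum {p : ℕ} {a : Fin p → ℝ} {ψ : ℕ → ℝ} (hψ : Summable ψ)
    (hrec : ∀ k : ℤ, zeroExtend ψ k =
      ∑ j : Fin p, a j * zeroExtend ψ (k - ((j : ℤ) + 1)) + if k = 0 then 1 else 0) :
    (∑' k, ψ k) * (1 - ∑ j, a j) = 1 := by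
  have hs := summable_zeroExtend hψ
  have hshift : ∀ c : ℤ, HasSum (fun k => zeroExtend ψ (k - c)) (∑' k, ψ k) := fun c => by
    rw [← tsum_zeroExtend]
    exact (Equiv.hasSum_iff (f := zeroExtend ψ) (Equiv.subRight c)).mpr hs.hasSum
  have h1 : HasSum (zeroExtend ψ) (∑ j : Fin p, a j * (∑' k, ψ k) + 1) := by
    refine HasSum.congr_fun ?_ fun k => hrec k
    exact (hasSum_sum fun j _ => (hshift _).mul_left (a j)).add (hasSum_ite_eq 0 1)
  have h2 := h1.unique hs.hasSum
  rw [tsum_zeroExtend, ← Finset.sum_mul] at h2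
  linear_combination -h2

theorem zeroExtend_eq_maCoeff {p : ℕ} {a : Fin p → ℝ} {ψ : ℕ → ℝ}
    (hrec : ∀ k : ℤ, zeroExtend ψ k =
      ∑ j : Fin p, a j * zeroExtend ψ (k - ((j : ℤ) + 1)) + if k = 0 then 1 else 0) :
    ψ = maCoeff a := by
  funext n
  induction n using Nat.strong_induction_on with
  | _ n ih =>
    have h := hrec n
    rw [zeroExtend_natCast] at h
    cases n with
    | zero =>
      rw [h, maCoeff]
      have : ∀ j : Fin p, zeroExtend ψ (((0 : ℕ) : ℤ) - ((j : ℤ) + 1)) = 0 :=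
        fun j => zeroExtend_of_neg ψ (by omega)
      simp only [this]
      simp
    | succ k =>
      rw [h, maCoeff, if_neg (by omega), add_zero]
      refine Finset.sum_congr rfl fun j _ => ?_
      split_ifs with hj
      · rw [show (((k + 1 : ℕ) : ℤ) - ((j : ℤ) + 1)) = ((k - (j : ℕ) : ℕ) : ℤ) by omega,
          zeroExtend_natCast, ih _ (by omega)]
      · rw [zeroExtend_of_neg ψ (by omega), mul_zero]

/-- The long-run variance of a moving average: the autocovariances sum to `ν² (∑ ψ)²`. -/
theorem hasSum_maAutocov (ν : ℝ) {ψ : ℕ → ℝ} (hψ : Summable fun k => |ψ k|) :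
    HasSum (maAutocov ν ψ) (ν ^ 2 * (∑' k, ψ k) ^ 2) := by
  have hψ' : Summable ψ := summable_abs_iff.mp hψ
  have hs := summable_zeroExtend hψ'
  have hprod : Summable fun x : ℕ × ℤ => ψ x.1 * zeroExtend ψ x.2 :=
    summable_mul_of_summable_norm (f := ψ) (g := zeroExtend ψ) hψ'.norm hs.norm
  let e : ℤ × ℕ ≃ ℕ × ℤ :=
    { toFun := fun x => (x.2, x.2 + x.1)
      invFun := fun x => (x.2 - x.1, x.1)
      left_inv := fun x => by simp
      right_inv := fun x => by simp }
  have h1 : HasSum (fun x : ℕ × ℤ => ψ x.1 * zeroExtend ψ x.2) ((∑' k, ψ k) ^ 2) := by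
    have := hψ'.hasSum.mul hs.hasSum hprod
    rwa [tsum_zeroExtend, ← sq] at this
  have h2 : HasSum (fun x : ℤ × ℕ => ψ x.2 * zeroExtend ψ (x.2 + x.1)) ((∑' k, ψ k) ^ 2) :=
    (Equiv.hasSum_iff (f := fun x : ℕ × ℤ => ψ x.1 * zeroExtend ψ x.2) e).mpr h1
  exact (h2.prod_fiberwise fun l => (h2.summable.prod_factor l).hasSum).mul_left (ν ^ 2)

/-- Geometric decay of the coefficients carries over to the autocovariances. -/
theorem abs_maAutocov_le (ν : ℝ) {ψ : ℕ → ℝ} (hψ : Summable fun k => |ψ k|) {θ K : ℝ}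
    (hθ : 1 < θ) (hK : ∀ n, |ψ n| ≤ K * θ⁻¹ ^ n) (h : ℕ) :
    |maAutocov ν ψ h| ≤ ν ^ 2 * (K * ∑' k, |ψ k|) * θ⁻¹ ^ h := by
  have hθ0 : 0 < θ⁻¹ := by positivity
  have hK0 : 0 ≤ K := by simpa using (abs_nonneg _).trans (hK 0)
  have hle : ∀ j : ℕ, |ψ j * zeroExtend ψ (j + (h : ℤ))| ≤ |ψ j| * (K * θ⁻¹ ^ h) := by
    intro j
    rw [← Nat.cast_add, zeroExtend_natCast, abs_mul]
    refine mul_le_mul_of_nonneg_left ((hK _).trans ?_) (abs_nonneg _)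
    refine mul_le_mul_of_nonneg_left ?_ hK0
    exact pow_le_pow_of_le_one hθ0.le (inv_le_one_of_one_le₀ hθ.le) (Nat.le_add_left _ _)
  have hsum : HasSum (fun j => |ψ j| * (K * θ⁻¹ ^ h)) ((∑' k, |ψ k|) * (K * θ⁻¹ ^ h)) :=
    hψ.hasSum.mul_right _
  rw [maAutocov, abs_mul, abs_of_nonneg (sq_nonneg ν), mul_assoc]
  refine mul_le_mul_of_nonneg_left ?_ (sq_nonneg ν)
  calc ‖∑' j : ℕ, ψ j * zeroExtend ψ (j + (h : ℤ))‖
      ≤ (∑' k, |ψ k|) * (K * θ⁻¹ ^ h) := tsum_of_norm_bounded hsum hle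
    _ = K * (∑' k, |ψ k|) * θ⁻¹ ^ h := by ring

end LinearProcess

/-! ### Causal AR processes in a Hilbert space -/

section Hilbert

variable {H : Type*} [NormedAddCommGroup H] [InnerProductSpace ℝ H]

/-- A Gram matrix is regular if its vectors have a triangular array of inner products, with
nonzero diagonal, with some other family of vectors. -/
theorem gram_det_ne_zero {p : ℕ} {D f : Fin p → H} (hlt : ∀ i j, i < j → inner ℝ (f i) (D j) = 0)
    (hdiag : ∀ i, inner ℝ (f i) (D i) ≠ 0) :
    (Matrix.of fun i j => inner ℝ (D i) (D j)).det ≠ 0 := by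
  intro hdet
  obtain ⟨v, hv, hv0⟩ := Matrix.exists_mulVec_eq_zero_iff.mpr hdet
  have hsum : ∑ j, v j • D j = 0 := by
    rw [← inner_self_eq_zero (𝕜 := ℝ)]
    calc inner ℝ (∑ j, v j • D j) (∑ j, v j • D j)
        = ∑ i, v i * (Matrix.mulVec (Matrix.of fun i j => inner ℝ (D i) (D j)) v) i := by
          simp only [sum_inner, inner_sum, real_inner_smul_left, real_inner_smul_right,
            Matrix.mulVec, dotProduct, Matrix.of_apply]
          refine Finset.sum_congr rfl fun i _ => ?_
          rw [Finset.mul_sum]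
          exact Finset.sum_congr rfl fun j _ => by rw [real_inner_comm]; ring
      _ = 0 := by simp [hv0]
  have hF : (Matrix.of fun i j => inner ℝ (f i) (D j)).det ≠ 0 := by
    rw [Matrix.det_of_isLowerTriangular]
    · exact Finset.prod_ne_zero_iff.mpr fun i _ => hdiag i
    · intro i j hij
      exact hlt i j hij
  refine hF (Matrix.exists_mulVec_eq_zero_iff.mp ⟨v, hv, ?_⟩)
  funext i
  have := congrArg (fun x => inner ℝ (f i) x) hsum
  simp only [inner_sum, real_inner_smul_right, inner_zero_right] at this
  simpa only [Matrix.mulVec, dotProduct, Matrix.of_apply, Pi.zero_apply, mul_comm] using this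

/-- The second-order structure of a causal AR(`p`) process, in a Hilbert space of random
variables: `e` are uncorrelated innovations of variance `ν ^ 2`, and `E` is the moving average
of `e` with coefficients `ψ` that solves the AR equation with parameters `a`. -/
structure IsHilbertAR {p : ℕ} (a : Fin p → ℝ) (ν : ℝ) (ψ : ℕ → ℝ) (e E : ℤ → H) : Prop where
  inner_noise : ∀ s t, inner ℝ (e s) (e t) = if s = t then ν ^ 2 else 0
  hasSum : ∀ t, HasSum (fun k : ℕ => ψ k • e (t - k)) (E t)
  ar_eq : ∀ t, E t = ∑ j : Fin p, a j • E (t - ((j : ℤ) + 1)) + e t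

namespace IsHilbertAR

variable {p : ℕ} {a : Fin p → ℝ} {ν : ℝ} {ψ : ℕ → ℝ} {e E : ℤ → H}

/-- The process is correlated with past and present noise only, by the coefficients `ψ`. -/
theorem inner_noise_process (h : IsHilbertAR a ν ψ e E) (s t : ℤ) :
    inner ℝ (e s) (E t) = ν ^ 2 * zeroExtend ψ (t - s) := by
  have h1 : HasSum (fun k : ℕ => inner ℝ (e s) (ψ k • e (t - k))) (inner ℝ (e s) (E t)) :=
    (innerSL ℝ (e s)).hasSum (h.hasSum t)
  refine h1.unique ?_
  simp only [real_inner_smul_right, h.inner_noise]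
  rcases le_or_gt s t with hst | hst
  · have h2 := hasSum_single (f := fun k : ℕ => ψ k * if s = t - (k : ℤ) then ν ^ 2 else 0)
      (t - s).toNat fun k hk => by
        rw [if_neg (by omega), mul_zero]
    rw [if_pos (by omega)] at h2
    rw [zeroExtend, if_pos (by omega), mul_comm]
    exact h2
  · rw [zeroExtend_of_neg ψ (by omega), mul_zero]
    refine hasSum_zero.congr_fun fun k => ?_
    rw [if_neg (by omega), mul_zero]

/-- The coefficients satisfy the recursion of the impulse responses: take inner products of the AR
equation with the noise. -/
theorem recursion (h : IsHilbertAR a ν ψ e E) (hν : 0 < ν) (k : ℤ) :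
    zeroExtend ψ k =
      ∑ j : Fin p, a j * zeroExtend ψ (k - ((j : ℤ) + 1)) + if k = 0 then 1 else 0 := by
  have h1 := h.inner_noise_process 0 k
  rw [h.ar_eq k, inner_add_right, inner_sum, h.inner_noise] at h1
  simp only [real_inner_smul_right, h.inner_noise_process, sub_zero] at h1
  have hν2 : ν ^ 2 ≠ 0 := by positivity
  refine mul_left_cancel₀ hν2 ?_
  rw [← h1, mul_add, Finset.mul_sum]
  congr 1
  · exact Finset.sum_congr rfl fun j _ => by ring
  · simp only [eq_comm (a := (0 : ℤ)), mul_ite, mul_one, mul_zero]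

theorem inner_process (h : IsHilbertAR a ν ψ e E) (s t : ℤ) :
    inner ℝ (E s) (E t) = maAutocov ν ψ (t - s) := by
  have h1 : HasSum (fun k : ℕ => inner ℝ (E t) (ψ k • e (s - k))) (inner ℝ (E t) (E s)) :=
    (innerSL ℝ (E t)).hasSum (h.hasSum s)
  rw [real_inner_comm, maAutocov, ← tsum_mul_left, ← h1.tsum_eq]
  refine tsum_congr fun k => ?_
  rw [real_inner_smul_right, real_inner_comm, h.inner_noise_process,
    show t - (s - (k : ℤ)) = k + (t - s) by ring]
  ring

theorem maAutocov_neg (h : IsHilbertAR a ν ψ e E) (l : ℤ) :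
    maAutocov ν ψ (-l) = maAutocov ν ψ l := by
  have h1 := h.inner_process 0 l
  rw [real_inner_comm, h.inner_process] at h1
  simpa using h1

theorem inner_diff (h : IsHilbertAR a ν ψ e E) (r s t : ℤ) :
    inner ℝ (E s - E (s - r)) (E t - E (t - r)) = diffAutocov (maAutocov ν ψ) r (t - s) := by
  simp only [inner_sub_left, inner_sub_right, h.inner_process, diffAutocov]
  rw [show t - (s - r) = t - s + r by ring, show t - r - s = t - s - r by ring,
    show t - r - (s - r) = t - s by ring]
  ring

/-- The differences solve the AR equation with the differenced noise as innovations. -/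
theorem diff_ar_eq (h : IsHilbertAR a ν ψ e E) (r t : ℤ) :
    E t - E (t - r) = ∑ j : Fin p, a j • (E (t - ((j : ℤ) + 1)) - E (t - ((j : ℤ) + 1) - r)) +
      (e t - e (t - r)) := by
  conv_lhs => rw [h.ar_eq t, h.ar_eq (t - r)]
  simp only [smul_sub, Finset.sum_sub_distrib, sub_right_comm t r]
  abel

/-- The Yule-Walker equations. -/
theorem yule_walker (h : IsHilbertAR a ν ψ e E) (i : Fin p) :
    ∑ j : Fin p, maAutocov ν ψ ((i : ℤ) - j) * a j = maAutocov ν ψ ((i : ℤ) + 1) := by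
  have h1 := h.inner_process (-((i : ℤ) + 1)) 0
  rw [h.ar_eq 0, inner_add_right, inner_sum, real_inner_comm (e 0), h.inner_noise_process,
    zeroExtend_of_neg ψ (by omega), mul_zero, add_zero] at h1
  rw [show (i : ℤ) + 1 = 0 - -((i : ℤ) + 1) by ring, ← h1]
  refine Finset.sum_congr rfl fun j _ => ?_
  rw [real_inner_smul_right, h.inner_process, mul_comm]
  congr 2
  ring

/-- The Yule-Walker equations of the `r`-th differences: as `Δ_r ε` solves the AR equation with
innovations `η_t - η_{t-r}`, the latter being correlated with the past of `Δ_r ε`, there is an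
additional term. -/
theorem yule_walker_diff (h : IsHilbertAR a ν ψ e E) (r : ℕ) (i : Fin p) :
    ∑ j : Fin p, diffAutocov (maAutocov ν ψ) r ((i : ℤ) - j) * a j =
      diffAutocov (maAutocov ν ψ) r ((i : ℤ) + 1) +
        ν ^ 2 * zeroExtend ψ ((r : ℤ) - ((i : ℤ) + 1)) := by
  have h1 := h.inner_diff r (-((i : ℤ) + 1)) 0
  rw [h.diff_ar_eq r 0, inner_add_right, inner_sum] at h1
  have h2 : inner ℝ (E (-((i : ℤ) + 1)) - E (-((i : ℤ) + 1) - r)) (e 0 - e (0 - r)) =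
      -(ν ^ 2 * zeroExtend ψ ((r : ℤ) - ((i : ℤ) + 1))) := by
    rw [real_inner_comm]
    simp only [inner_sub_left, inner_sub_right, h.inner_noise_process]
    rw [zeroExtend_of_neg ψ (k := -((i : ℤ) + 1) - 0) (by omega),
      zeroExtend_of_neg ψ (k := -((i : ℤ) + 1) - r - 0) (by omega),
      zeroExtend_of_neg ψ (k := -((i : ℤ) + 1) - r - (0 - r)) (by omega),
      show -((i : ℤ) + 1) - (0 - r) = (r : ℤ) - ((i : ℤ) + 1) by ring]
    ring
  rw [h2] at h1
  have h3 : ∀ j : Fin p, inner ℝ (E (-((i : ℤ) + 1)) - E (-((i : ℤ) + 1) - r))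
      (a j • (E (0 - ((j : ℤ) + 1)) - E (0 - ((j : ℤ) + 1) - r))) =
      diffAutocov (maAutocov ν ψ) r ((i : ℤ) - j) * a j := by
    intro j
    rw [real_inner_smul_right, h.inner_diff, mul_comm]
    congr 2
    ring
  simp only [h3] at h1
  rw [show 0 - -((i : ℤ) + 1) = (i : ℤ) + 1 by ring] at h1
  linarith

/-- The autocovariance matrix of a causal AR process is regular. -/
theorem det_autocov_ne_zero (h : IsHilbertAR a ν ψ e E) (hν : 0 < ν) :
    (Matrix.of fun i j : Fin p => maAutocov ν ψ ((i : ℤ) - j)).det ≠ 0 := by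
  have h0 : ψ 0 = 1 := by
    rw [zeroExtend_eq_maCoeff (h.recursion hν), maCoeff]
  have hg := gram_det_ne_zero (D := fun i : Fin p => E (-(i : ℤ)))
    (f := fun i : Fin p => e (-(i : ℤ)))
    (fun i j hij => by
      have : (i : ℕ) < j := hij
      rw [h.inner_noise_process, zeroExtend_of_neg ψ (by omega), mul_zero])
    (fun i => by
      rw [h.inner_noise_process, sub_self, ← Nat.cast_zero, zeroExtend_natCast, h0]
      positivity)
  simpa only [h.inner_process, neg_sub_neg] using hg

/-- The autocovariance matrix of the differences of a causal AR process is regular. -/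
theorem det_diffAutocov_ne_zero (h : IsHilbertAR a ν ψ e E) (hν : 0 < ν) {r : ℕ} (hr : 1 ≤ r) :
    (Matrix.of fun i j : Fin p => diffAutocov (maAutocov ν ψ) r ((i : ℤ) - j)).det ≠ 0 := by
  have h0 : ψ 0 = 1 := by
    rw [zeroExtend_eq_maCoeff (h.recursion hν), maCoeff]
  have hg := gram_det_ne_zero (D := fun i : Fin p => E (-(i : ℤ)) - E (-(i : ℤ) - r))
    (f := fun i : Fin p => e (-(i : ℤ)))
    (fun i j hij => by
      have : (i : ℕ) < j := hij
      rw [inner_sub_right, h.inner_noise_process, h.inner_noise_process,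
        zeroExtend_of_neg ψ (by omega), zeroExtend_of_neg ψ (by omega), mul_zero, sub_zero])
    (fun i => by
      rw [inner_sub_right, h.inner_noise_process, h.inner_noise_process, sub_self,
        zeroExtend_of_neg ψ (k := -(i : ℤ) - r - -(i : ℤ)) (by omega), mul_zero, sub_zero,
        ← Nat.cast_zero, zeroExtend_natCast, h0]
      positivity)
  simpa only [h.inner_diff, neg_sub_neg] using hg

/-- The residuals of the first differences at the true parameters are `η_t - η_{t-1}`, of
variance `2 ν²`. -/
theorem residual_variance (h : IsHilbertAR a ν ψ e E) :
    diffAutocov (maAutocov ν ψ) 1 0 -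
        2 * ∑ j : Fin p, a j * diffAutocov (maAutocov ν ψ) 1 ((j : ℤ) + 1) +
        ∑ j : Fin p, ∑ k : Fin p,
          a j * a k * diffAutocov (maAutocov ν ψ) 1 ((j : ℤ) - k) = 2 * ν ^ 2 := by
  set S := ∑ j : Fin p, a j • (E (0 - ((j : ℤ) + 1)) - E (0 - ((j : ℤ) + 1) - 1)) with hS
  have hD : E 0 - E (0 - 1) - S = e 0 - e (0 - 1) := by
    rw [h.diff_ar_eq 1 0, add_sub_cancel_left]
  have h1 : inner ℝ (e 0 - e (0 - 1)) (e 0 - e (0 - 1)) = 2 * ν ^ 2 := by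
    simp only [inner_sub_left, inner_sub_right, h.inner_noise]
    norm_num
    ring
  rw [← h1, ← hD]
  have h2 : inner ℝ S (E 0 - E (0 - 1)) =
      ∑ j : Fin p, a j * diffAutocov (maAutocov ν ψ) 1 ((j : ℤ) + 1) := by
    rw [hS, sum_inner]
    refine Finset.sum_congr rfl fun j _ => ?_
    rw [real_inner_smul_left, h.inner_diff]
    congr 2
    ring
  have h3 : inner ℝ S S = ∑ j : Fin p, ∑ k : Fin p,
      a j * a k * diffAutocov (maAutocov ν ψ) 1 ((j : ℤ) - k) := by
    rw [hS, sum_inner]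
    refine Finset.sum_congr rfl fun j _ => ?_
    rw [inner_sum]
    refine Finset.sum_congr rfl fun k _ => ?_
    rw [real_inner_smul_left, real_inner_smul_right, h.inner_diff, mul_assoc]
    congr 3
    ring
  rw [inner_sub_left (E 0 - E (0 - 1)) S, inner_sub_right (E 0 - E (0 - 1)) _ S,
    inner_sub_right S _ S, real_inner_comm S, h2, h3, h.inner_diff, sub_self]
  ring

end IsHilbertAR

end Hilbert

variable {Ω : Type*} [MeasurableSpace Ω] {P : Measure Ω}

theorem eLpNorm_two_eq_ofReal_sqrt {f : Ω → ℝ} (hf : MemLp f 2 P) :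
    eLpNorm f 2 P = ENNReal.ofReal √(∫ ω, f ω ^ 2 ∂P) := by
  rw [hf.eLpNorm_eq_integral_rpow_norm (by norm_num) (by norm_num)]
  congr 1
  simp only [ENNReal.toReal_ofNat, Real.rpow_two, Real.norm_eq_abs, sq_abs]
  rw [Real.sqrt_eq_rpow, one_div]

/-! ### Products of i.i.d. innovations -/

section Noise

variable {ν : ℝ} {η : ℤ → Ω → ℝ}

/-- The centred product `η_s η_t - E[η_s η_t]` of two innovations of variance `ν ^ 2`. -/
noncomputable def centredProduct (ν : ℝ) (η : ℤ → Ω → ℝ) (s t : ℤ) (ω : Ω) : ℝ :=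
  η s ω * η t ω - if s = t then ν ^ 2 else 0

namespace IsIIDNoise

theorem integral_mul (h : IsIIDNoise P ν η) (s t : ℤ) :
    ∫ ω, η s ω * η t ω ∂P = if s = t then ν ^ 2 else 0 := by
  split_ifs with hst
  · subst hst
    simpa only [sq] using h.second_moment s
  · rw [(h.indep.indepFun hst).integral_fun_mul_eq_mul_integral
      (h.measurable s).aestronglyMeasurable (h.measurable t).aestronglyMeasurable,
      h.mean_zero, zero_mul]

theorem memLp_mul (h4 : ∀ t, MemLp (η t) 4 P) (s t : ℤ) :
    MemLp (fun ω => η s ω * η t ω) 2 P := by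
  have : ENNReal.HolderTriple 4 4 2 := ⟨by
    rw [← two_mul, show (4 : ENNReal) = 2 * 2 by norm_num, ENNReal.mul_inv (by simp) (by simp),
      ← mul_assoc, ENNReal.mul_inv_cancel (by simp) (by simp), one_mul]⟩
  exact (h4 t).mul (h4 s)

/-- An innovation is orthogonal to products of three other innovations. -/
theorem integral_mul_triple_eq_zero (h : IsIIDNoise P ν η) {n i j k : ℤ} (hi : i ≠ n)
    (hj : j ≠ n) (hk : k ≠ n) : ∫ ω, η n ω * (η i ω * η j ω * η k ω) ∂P = 0 := by
  have hind := h.indep.indepFun_finset {n} {i, j, k} (by simp [Ne.symm hi, Ne.symm hj, Ne.symm hk])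
    h.measurable
  have hind2 : IndepFun (η n) (fun ω => η i ω * η j ω * η k ω) P :=
    hind.comp (φ := fun x : ({n} : Finset ℤ) → ℝ => x ⟨n, by simp⟩)
      (ψ := fun x : ({i, j, k} : Finset ℤ) → ℝ =>
        x ⟨i, by simp⟩ * x ⟨j, by simp⟩ * x ⟨k, by simp⟩)
      (by fun_prop) (by fun_prop)
  rw [hind2.integral_fun_mul_eq_mul_integral (h.measurable n).aestronglyMeasurable
    (((h.measurable i).mul (h.measurable j)).mul (h.measurable k)).aestronglyMeasurable,
    h.mean_zero, zero_mul]

theorem integrable_pow_four (h4 : ∀ t, MemLp (η t) 4 P) (t : ℤ) :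
    Integrable (fun ω => η t ω ^ 4) P := by
  have := (h4 t).integrable_norm_pow (p := 4) (by norm_num)
  simpa only [Real.norm_eq_abs, Even.pow_abs (show Even 4 by decide)] using this

theorem integral_pow_four (h : IsIIDNoise P ν η) (t : ℤ) :
    ∫ ω, η t ω ^ 4 ∂P = ∫ ω, η 0 ω ^ 4 ∂P :=
  ((h.identDistrib t).comp (u := fun x : ℝ => x ^ 4) (by fun_prop)).integral_eq

variable [IsProbabilityMeasure P]

theorem memLp_two (h4 : ∀ t, MemLp (η t) 4 P) (t : ℤ) : MemLp (η t) 2 P :=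
  (h4 t).mono_exponent (by norm_num)

theorem memLp_centredProduct (h4 : ∀ t, MemLp (η t) 4 P) (s t : ℤ) :
    MemLp (centredProduct ν η s t) 2 P :=
  (memLp_mul h4 s t).sub (memLp_const _)

/-- Time shifts of a centred product are uncorrelated: if the two innovations are distinct, the
latest of the four innovations involved occurs only once. -/
theorem integral_centredProduct_mul (h : IsIIDNoise P ν η) (h4 : ∀ t, MemLp (η t) 4 P) (x y : ℤ)
    {t t' : ℤ} (htt' : t ≠ t') :
    ∫ ω, centredProduct ν η (t - x) (t - y) ω * centredProduct ν η (t' - x) (t' - y) ω ∂P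
      = 0 := by
  by_cases hxy : x = y
  · subst hxy
    have hg : Measurable fun u : ℝ => u * u - ν ^ 2 := by fun_prop
    have hind := (h.indep.indepFun (show t - x ≠ t' - x by omega)).comp hg hg
    have hint := hind.integral_fun_mul_eq_mul_integral
      (hg.comp (h.measurable _)).aestronglyMeasurable
      (hg.comp (h.measurable _)).aestronglyMeasurable
    simp only [Function.comp_def] at hint
    simp only [centredProduct, if_true]
    have hi : Integrable (fun ω => η (t - x) ω * η (t - x) ω) P :=
      (memLp_two h4 _).integrable_mul (memLp_two h4 _)
    rw [hint, integral_sub hi (integrable_const _), h.integral_mul]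
    simp
  · have hne : ∀ u : ℤ, u - x ≠ u - y := fun u => by omega
    simp only [centredProduct, if_neg (hne _), sub_zero]
    rcases lt_or_gt_of_ne hxy with hlt | hlt <;> rcases lt_or_gt_of_ne htt' with hlt' | hlt'
    · rw [← h.integral_mul_triple_eq_zero (n := t' - x) (i := t - x) (j := t - y) (k := t' - y)
        (by omega) (by omega) (by omega)]
      exact integral_congr_ae (.of_forall fun ω => by ring)
    · rw [← h.integral_mul_triple_eq_zero (n := t - x) (i := t' - x) (j := t - y) (k := t' - y)
        (by omega) (by omega) (by omega)]
      exact integral_congr_ae (.of_forall fun ω => by ring)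
    · rw [← h.integral_mul_triple_eq_zero (n := t' - y) (i := t - x) (j := t - y) (k := t' - x)
        (by omega) (by omega) (by omega)]
      exact integral_congr_ae (.of_forall fun ω => by ring)
    · rw [← h.integral_mul_triple_eq_zero (n := t - y) (i := t - x) (j := t' - x) (k := t' - y)
        (by omega) (by omega) (by omega)]
      exact integral_congr_ae (.of_forall fun ω => by ring)

theorem integral_centredProduct_sq_le (h : IsIIDNoise P ν η) (h4 : ∀ t, MemLp (η t) 4 P)
    (s t : ℤ) : ∫ ω, centredProduct ν η s t ω ^ 2 ∂P ≤ ∫ ω, η 0 ω ^ 4 ∂P := by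
  by_cases hst : s = t
  · subst hst
    have h2 : Integrable (fun ω => 2 * ν ^ 2 * (η s ω * η s ω)) P :=
      ((memLp_two h4 s).integrable_mul (memLp_two h4 s)).const_mul _
    have h3 : Integrable (fun ω => η s ω ^ 4 - 2 * ν ^ 2 * (η s ω * η s ω)) P :=
      (integrable_pow_four h4 s).sub h2
    have hexp : ∀ ω, centredProduct ν η s s ω ^ 2 =
        η s ω ^ 4 - 2 * ν ^ 2 * (η s ω * η s ω) + ν ^ 4 := fun ω => by
      simp only [centredProduct, if_true]; ring
    simp only [hexp]
    rw [integral_add h3 (integrable_const _),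
      integral_sub (integrable_pow_four h4 s) h2, integral_const_mul,
      h.integral_mul, h.integral_pow_four]
    simp only [if_true, integral_const, probReal_univ, one_smul]
    nlinarith [sq_nonneg (ν ^ 2)]
  · calc ∫ ω, centredProduct ν η s t ω ^ 2 ∂P
        ≤ ∫ ω, 2⁻¹ * (η s ω ^ 4 + η t ω ^ 4) ∂P := by
          refine integral_mono (memLp_centredProduct h4 s t).integrable_sq
            (((integrable_pow_four h4 s).add (integrable_pow_four h4 t)).const_mul _) fun ω => ?_
          simp only [centredProduct, if_neg hst, sub_zero]
          nlinarith [sq_nonneg (η s ω ^ 2 - η t ω ^ 2)]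
      _ = ∫ ω, η 0 ω ^ 4 ∂P := by
          rw [integral_const_mul, integral_add (integrable_pow_four h4 s)
            (integrable_pow_four h4 t), h.integral_pow_four s, h.integral_pow_four t]
          ring

theorem eLpNorm_sum_centredProduct_le (h : IsIIDNoise P ν η) (h4 : ∀ t, MemLp (η t) 4 P)
    (I : Finset ℤ) (x y : ℤ) :
    eLpNorm (fun ω => ∑ t ∈ I, centredProduct ν η (t - x) (t - y) ω) 2 P ≤
      ENNReal.ofReal √((∫ ω, η 0 ω ^ 4 ∂P) * (I.card : ℝ)) := by
  have hmem : ∀ t, MemLp (centredProduct ν η (t - x) (t - y)) 2 P := fun t =>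
    memLp_centredProduct h4 _ _
  have hint : ∀ t t', Integrable (fun ω => centredProduct ν η (t - x) (t - y) ω *
      centredProduct ν η (t' - x) (t' - y) ω) P := fun t t' => (hmem t).integrable_mul (hmem t')
  rw [eLpNorm_two_eq_ofReal_sqrt (memLp_finsetSum I fun t _ => hmem t)]
  refine ENNReal.ofReal_le_ofReal (Real.sqrt_le_sqrt ?_)
  calc ∫ ω, (∑ t ∈ I, centredProduct ν η (t - x) (t - y) ω) ^ 2 ∂P
      = ∑ t ∈ I, ∑ t' ∈ I, ∫ ω, centredProduct ν η (t - x) (t - y) ω *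
          centredProduct ν η (t' - x) (t' - y) ω ∂P := by
        simp only [sq, Finset.sum_mul_sum]
        rw [integral_finsetSum _ fun t _ => integrable_finsetSum _ fun t' _ => hint t t']
        exact Finset.sum_congr rfl fun t _ => integral_finsetSum _ fun t' _ => hint t t'
    _ = ∑ t ∈ I, ∫ ω, centredProduct ν η (t - x) (t - y) ω ^ 2 ∂P := by
        refine Finset.sum_congr rfl fun t ht => ?_
        rw [Finset.sum_eq_single_of_mem t ht fun t' _ hne =>
          h.integral_centredProduct_mul h4 x y hne.symm]
        simp only [sq]
    _ ≤ ∑ _t ∈ I, ∫ ω, η 0 ω ^ 4 ∂P :=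
        Finset.sum_le_sum fun t _ => h.integral_centredProduct_sq_le h4 _ _
    _ = (∫ ω, η 0 ω ^ 4 ∂P) * (I.card : ℝ) := by
        rw [Finset.sum_const, nsmul_eq_mul, mul_comm]

/-- Truncated moving averages: by Minkowski's inequality the bound for products of innovations
carries over, with a constant depending on the `ℓ¹` norm of the coefficients only. -/
theorem eLpNorm_sum_partial_le (h : IsIIDNoise P ν η) (h4 : ∀ t, MemLp (η t) 4 P)
    {ψ : ℕ → ℝ} (hψ : Summable fun k => |ψ k|) (I : Finset ℤ) (x y : ℤ) (N : ℕ) :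
    eLpNorm (fun ω => ∑ t ∈ I, ∑ j ∈ Finset.range N, ∑ k ∈ Finset.range N,
        ψ j * ψ k * centredProduct ν η (t - x - j) (t - y - k) ω) 2 P ≤
      ENNReal.ofReal ((∑' k, |ψ k|) ^ 2 * √((∫ ω, η 0 ω ^ 4 ∂P) * (I.card : ℝ))) := by
  set B : ℝ := √((∫ ω, η 0 ω ^ 4 ∂P) * (I.card : ℝ)) with hB
  have hfun : (fun ω => ∑ t ∈ I, ∑ j ∈ Finset.range N, ∑ k ∈ Finset.range N,
        ψ j * ψ k * centredProduct ν η (t - x - j) (t - y - k) ω) =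
      ∑ z ∈ Finset.range N ×ˢ Finset.range N, (ψ z.1 * ψ z.2) •
        fun ω => ∑ t ∈ I, centredProduct ν η (t - (x + z.1)) (t - (y + z.2)) ω := by
    funext ω
    rw [Finset.sum_product, Finset.sum_apply, Finset.sum_comm]
    refine Finset.sum_congr rfl fun j _ => ?_
    rw [Finset.sum_comm, Finset.sum_apply]
    refine Finset.sum_congr rfl fun k _ => ?_
    simp only [Pi.smul_apply, smul_eq_mul, Finset.mul_sum, sub_sub]
  have hmem : ∀ x' y' : ℤ, MemLp (fun ω => ∑ t ∈ I, centredProduct ν η (t - x') (t - y') ω) 2 P :=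
    fun x' y' => memLp_finsetSum I fun t _ => memLp_centredProduct h4 _ _
  rw [hfun]
  calc eLpNorm (∑ z ∈ Finset.range N ×ˢ Finset.range N, (ψ z.1 * ψ z.2) •
        fun ω => ∑ t ∈ I, centredProduct ν η (t - (x + z.1)) (t - (y + z.2)) ω) 2 P
      ≤ ∑ z ∈ Finset.range N ×ˢ Finset.range N, ENNReal.ofReal (|ψ z.1| * |ψ z.2| * B) := by
        refine (eLpNorm_sum_le (fun z _ => ((hmem _ _).const_smul _).1) (by norm_num)).trans
          (Finset.sum_le_sum fun z _ => ?_)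
        rw [eLpNorm_const_smul, ENNReal.ofReal_mul (by positivity), ← abs_mul,
          ← Real.norm_eq_abs, ofReal_norm]
        gcongr
        exact h.eLpNorm_sum_centredProduct_le h4 I _ _
    _ = ENNReal.ofReal ((∑ k ∈ Finset.range N, |ψ k|) ^ 2 * B) := by
        rw [← ENNReal.ofReal_sum_of_nonneg fun z _ => by positivity, ← Finset.sum_mul, sq,
          Finset.sum_mul_sum, Finset.sum_product]
    _ ≤ ENNReal.ofReal ((∑' k, |ψ k|) ^ 2 * B) := by
        refine ENNReal.ofReal_le_ofReal ?_
        have := hψ.sum_le_tsum (Finset.range N) fun _ _ => abs_nonneg _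
        gcongr

end IsIIDNoise

end Noise

/-! ### Second moments of linear processes -/

section LinearProcessMoments

theorem integral_mul_eq_inner {f g : Ω → ℝ} {F G : Lp ℝ 2 P} (hf : F =ᵐ[P] f) (hg : G =ᵐ[P] g) :
    ∫ ω, f ω * g ω ∂P = inner ℝ F G := by
  rw [L2.inner_def]
  refine integral_congr_ae ?_
  filter_upwards [hf, hg] with ω h1 h2
  simp [h1, h2, mul_comm]

variable [IsProbabilityMeasure P] {p : ℕ} {a : Fin p → ℝ} {ν : ℝ} {ψ : ℕ → ℝ}
  {η ε : ℤ → Ω → ℝ}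

/-- The almost sure moving average representation also holds in `L²`, so that a causal AR process
has the abstract Hilbert space structure. -/
theorem exists_isHilbertAR (hη : IsIIDNoise P ν η) (hη4 : ∀ t, MemLp (η t) 4 P)
    (hε : IsCausalAR P a η ε) (hψ : Summable fun k => |ψ k|)
    (hsum : ∀ t : ℤ, ∀ᵐ ω ∂P, HasSum (fun k : ℕ => ψ k * η (t - (k : ℤ)) ω) (ε t ω)) :
    ∃ e E : ℤ → Lp ℝ 2 P, IsHilbertAR a ν ψ e E ∧ (∀ t, e t =ᵐ[P] η t) ∧ ∀ t, E t =ᵐ[P] ε t := by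
  set e : ℤ → Lp ℝ 2 P := fun t => (IsIIDNoise.memLp_two hη4 t).toLp (η t) with he
  have hcoe : ∀ t, e t =ᵐ[P] η t := fun t => MemLp.coeFn_toLp _
  have hinner : ∀ s t, inner ℝ (e s) (e t) = if s = t then ν ^ 2 else 0 := by
    intro s t
    rw [L2.inner_def, ← hη.integral_mul s t]
    refine integral_congr_ae ?_
    filter_upwards [hcoe s, hcoe t] with ω h1 h2
    simp [h1, h2, mul_comm]
  have hnorm : ∀ t, ‖e t‖ = |ν| := by
    intro t
    have := hinner t t
    rw [if_pos rfl, real_inner_self_eq_norm_sq] at this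
    rw [← abs_norm, ← sq_eq_sq_iff_abs_eq_abs, this]
  have hE : ∀ t, Summable fun k : ℕ => ψ k • e (t - k) := fun t => by
    refine Summable.of_norm ?_
    simp only [norm_smul, hnorm, Real.norm_eq_abs]
    exact hψ.mul_right _
  set E : ℤ → Lp ℝ 2 P := fun t => ∑' k : ℕ, ψ k • e (t - k) with hEdef
  have hEε : ∀ t, E t =ᵐ[P] ε t := by
    intro t
    have hL2 := tendstoInMeasure_of_tendsto_Lp (hE t).hasSum.tendsto_sum_nat
    have hpart : ∀ N : ℕ, (↑(∑ k ∈ Finset.range N, ψ k • e (t - k)) : Ω → ℝ) =ᵐ[P]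
        fun ω => ∑ k ∈ Finset.range N, ψ k * η (t - k) ω := by
      intro N
      refine (Lp.coeFn_finsetSum _ _).trans ?_
      have hall : ∀ᵐ ω ∂P, ∀ k : ℕ, (ψ k • e (t - k) : Lp ℝ 2 P) ω = ψ k * η (t - k) ω := by
        rw [ae_all_iff]
        intro k
        filter_upwards [Lp.coeFn_smul (ψ k) (e (t - k)), hcoe (t - k)] with ω h1 h2
        rw [h1, Pi.smul_apply, h2, smul_eq_mul]
      filter_upwards [hall] with ω hω
      rw [Finset.sum_apply]
      exact Finset.sum_congr rfl fun k _ => hω k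
    have hae : TendstoInMeasure P
        (fun (N : ℕ) ω => ∑ k ∈ Finset.range N, ψ k * η (t - k) ω) atTop (ε t) := by
      refine tendstoInMeasure_of_tendsto_ae (fun N => ?_) ?_
      · exact (Finset.measurable_fun_sum _ fun k _ =>
          (hη.measurable _).const_mul _).aestronglyMeasurable
      · filter_upwards [hsum t] with ω hω
        exact hω.tendsto_sum_nat
    exact tendstoInMeasure_ae_unique (hL2.congr_left hpart) hae
  refine ⟨e, E, ⟨hinner, fun t => (hE t).hasSum, fun t => ?_⟩, hcoe, hEε⟩
  refine Lp.ext ?_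
  have hall : ∀ᵐ ω ∂P, ∀ j : Fin p, (a j • E (t - ((j : ℤ) + 1)) : Lp ℝ 2 P) ω =
      a j * ε (t - ((j : ℤ) + 1)) ω := by
    rw [ae_all_iff]
    intro j
    filter_upwards [Lp.coeFn_smul (a j) (E (t - ((j : ℤ) + 1))), hEε (t - ((j : ℤ) + 1))]
      with ω h1 h2
    rw [h1, Pi.smul_apply, h2, smul_eq_mul]
  filter_upwards [hEε t, hε.ar_eq t, hall, hcoe t, Lp.coeFn_add
    (∑ j : Fin p, a j • E (t - ((j : ℤ) + 1))) (e t),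
    Lp.coeFn_finsetSum Finset.univ fun j : Fin p => a j • E (t - ((j : ℤ) + 1))]
    with ω h1 h2 h3 h4 h5 h6
  rw [h1, h2, h5, Pi.add_apply, h6, h4, Finset.sum_apply]
  simp only [h3]

/-- The sample second moments of a linear process have `L²` errors of the order of the square
root of the number of summands, uniformly in the lag. The truncated moving averages satisfy the
bound, and Fatou's lemma passes it to the limit. -/
theorem eLpNorm_sum_mul_sub_le (hη : IsIIDNoise P ν η) (hη4 : ∀ t, MemLp (η t) 4 P)
    (hψ : Summable fun k => |ψ k|)
    (hsum : ∀ t : ℤ, ∀ᵐ ω ∂P, HasSum (fun k : ℕ => ψ k * η (t - (k : ℤ)) ω) (ε t ω))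
    {e E : ℤ → Lp ℝ 2 P} (h : IsHilbertAR a ν ψ e E) (I : Finset ℤ) (x y : ℤ) :
    eLpNorm (fun ω => ∑ t ∈ I, (ε (t - x) ω * ε (t - y) ω - maAutocov ν ψ (x - y))) 2 P ≤
      ENNReal.ofReal ((∑' k, |ψ k|) ^ 2 * √((∫ ω, η 0 ω ^ 4 ∂P) * (I.card : ℝ))) := by
  set F : ℕ → Ω → ℝ := fun N ω => ∑ t ∈ I, ∑ j ∈ Finset.range N, ∑ k ∈ Finset.range N,
        ψ j * ψ k * centredProduct ν η (t - x - j) (t - y - k) ω with hF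
  have hFmeas : ∀ N, AEStronglyMeasurable (F N) P := by
    intro N
    have hm := hη.measurable
    refine Measurable.aestronglyMeasurable ?_
    simp only [hF, centredProduct]
    fun_prop
  have hFeq : ∀ N ω, F N ω = ∑ t ∈ I,
      ((∑ j ∈ Finset.range N, ψ j * η (t - x - j) ω) *
          (∑ k ∈ Finset.range N, ψ k * η (t - y - k) ω) -
        inner ℝ (∑ j ∈ Finset.range N, ψ j • e (t - x - j))
          (∑ k ∈ Finset.range N, ψ k • e (t - y - k))) := by
    intro N ω
    refine Finset.sum_congr rfl fun t _ => ?_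
    rw [sum_inner, Finset.sum_mul_sum, ← Finset.sum_sub_distrib]
    refine Finset.sum_congr rfl fun j _ => ?_
    rw [inner_sum, ← Finset.sum_sub_distrib]
    refine Finset.sum_congr rfl fun k _ => ?_
    rw [real_inner_smul_left, real_inner_smul_right, h.inner_noise, centredProduct]
    ring
  have hlim : ∀ᵐ ω ∂P, Tendsto (fun N => F N ω) atTop
      (𝓝 (∑ t ∈ I, (ε (t - x) ω * ε (t - y) ω - maAutocov ν ψ (x - y)))) := by
    have hall : ∀ᵐ ω ∂P, ∀ t : ℤ, HasSum (fun k : ℕ => ψ k * η (t - (k : ℤ)) ω) (ε t ω) :=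
      ae_all_iff.mpr hsum
    filter_upwards [hall] with ω hω
    simp only [hFeq]
    refine tendsto_finsetSum _ fun t _ => Tendsto.sub ?_ ?_
    · exact (hω _).tendsto_sum_nat.mul (hω _).tendsto_sum_nat
    · have := (h.hasSum (t - x)).tendsto_sum_nat.inner (𝕜 := ℝ) (h.hasSum (t - y)).tendsto_sum_nat
      rwa [h.inner_process, show t - y - (t - x) = x - y by ring] at this
  refine (Lp.eLpNorm_lim_le_liminf_eLpNorm hFmeas _ hlim).trans ?_
  refine (liminf_le_liminf (.of_forall fun N =>
    hη.eLpNorm_sum_partial_le hη4 hψ I x y N)).trans ?_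
  simp

end LinearProcessMoments

/-! ### Sample second moments of differenced data -/

section SampleMoments

/-- The sums of `n` products `ε_{t-x} ε_{t-y}` estimate `n γ (x - y)` with an `L²` error of at most
`K √n`, uniformly in the shifts `x` and `y`. The constant `K` also bounds the first absolute
moments of `ε` and the values of `γ`. -/
structure SampleMomentBound (P : Measure Ω) (ε : ℤ → Ω → ℝ) (γ : ℤ → ℝ) (K : ℝ) : Prop where
  memLp : ∀ t, MemLp (ε t) 2 P
  integral_abs_le : ∀ t, ∫ ω, |ε t ω| ∂P ≤ K
  abs_autocov_le : ∀ h, |γ h| ≤ K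
  eLpNorm_le : ∀ (I : Finset ℤ) (x y : ℤ),
    eLpNorm (fun ω => ∑ t ∈ I, (ε (t - x) ω * ε (t - y) ω - γ (x - y))) 2 P ≤
      ENNReal.ofReal (K * √(I.card : ℝ))

namespace SampleMomentBound

variable {ε : ℤ → Ω → ℝ} {γ : ℤ → ℝ} {K : ℝ}

theorem nonneg (h : SampleMomentBound P ε γ K) : 0 ≤ K :=
  (abs_nonneg _).trans (h.abs_autocov_le 0)

theorem abs_diffAutocov_le (h : SampleMomentBound P ε γ K) (r l : ℤ) :
    |diffAutocov γ r l| ≤ 4 * K := by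
  have h1 := abs_le.mp (h.abs_autocov_le l)
  have h2 := abs_le.mp (h.abs_autocov_le (l + r))
  have h3 := abs_le.mp (h.abs_autocov_le (l - r))
  rw [diffAutocov, abs_le]
  constructor <;> linarith [h1.1, h1.2, h2.1, h2.2, h3.1, h3.2]

variable [IsProbabilityMeasure P]

/-- The bound for the differences: each product of differences is a sum of four products. -/
theorem eLpNorm_diff_le (h : SampleMomentBound P ε γ K) (I : Finset ℤ) (q : ℕ) (i j : ℤ) :
    eLpNorm (fun ω => ∑ t ∈ I, ((ε (t - i) ω - ε (t - i - q) ω) *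
      (ε (t - j) ω - ε (t - j - q) ω) - diffAutocov γ q (i - j))) 1 P ≤
      ENNReal.ofReal (4 * K * √(I.card : ℝ)) := by
  set W : ℤ → ℤ → Ω → ℝ := fun x y ω => ∑ t ∈ I, (ε (t - x) ω * ε (t - y) ω - γ (x - y)) with hW
  have hmeas : ∀ x y, AEStronglyMeasurable (W x y) P := fun x y => by
    refine Finset.aestronglyMeasurable_fun_sum I fun t _ => ?_
    exact (((h.memLp _).1.mul (h.memLp _).1).sub aestronglyMeasurable_const)
  have hle : ∀ x y, eLpNorm (W x y) 1 P ≤ ENNReal.ofReal (K * √(I.card : ℝ)) := fun x y =>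
    (eLpNorm_le_eLpNorm_of_exponent_le (by norm_num) (hmeas x y)).trans (h.eLpNorm_le I x y)
  have heq : (fun ω => ∑ t ∈ I, ((ε (t - i) ω - ε (t - i - q) ω) *
      (ε (t - j) ω - ε (t - j - q) ω) - diffAutocov γ q (i - j))) =
      (W i j + W (i + q) (j + q)) - (W i (j + q) + W (i + q) j) := by
    funext ω
    simp only [hW, Pi.add_apply, Pi.sub_apply, ← Finset.sum_add_distrib,
      ← Finset.sum_sub_distrib, diffAutocov, sub_sub]
    refine Finset.sum_congr rfl fun t _ => ?_
    rw [show i + (q : ℤ) - (j + q) = i - j by ring, show i - (j + (q : ℤ)) = i - j - q by ring,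
      show i + (q : ℤ) - j = i - j + q by ring]
    simp only [sub_sub]
    ring
  have hB : 0 ≤ K * √(I.card : ℝ) := mul_nonneg h.nonneg (Real.sqrt_nonneg _)
  rw [heq]
  refine (eLpNorm_sub_le ((hmeas _ _).add (hmeas _ _)) ((hmeas _ _).add (hmeas _ _))
    le_rfl).trans ?_
  refine (add_le_add (eLpNorm_add_le (hmeas _ _) (hmeas _ _) le_rfl)
    (eLpNorm_add_le (hmeas _ _) (hmeas _ _) le_rfl)).trans ?_
  refine (add_le_add (add_le_add (hle _ _) (hle _ _)) (add_le_add (hle _ _) (hle _ _))).trans ?_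
  rw [← ENNReal.ofReal_add hB hB, ← ENNReal.ofReal_add (by positivity) (by positivity)]
  exact ENNReal.ofReal_le_ofReal (by linarith)

end SampleMomentBound

theorem eLpNorm_one_le_of_abs_le {f g : Ω → ℝ} {c : ℝ} (hg : Integrable g P)
    (hfg : ∀ ω, |f ω| ≤ g ω) (hc : ∫ ω, g ω ∂P ≤ c) : eLpNorm f 1 P ≤ ENNReal.ofReal c := by
  have hg0 : ∀ ω, 0 ≤ g ω := fun ω => (abs_nonneg _).trans (hfg ω)
  calc eLpNorm f 1 P ≤ eLpNorm g 1 P := eLpNorm_mono_real hfg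
    _ = ENNReal.ofReal (∫ ω, g ω ∂P) := by
        rw [eLpNorm_one_eq_lintegral_enorm, ← ofReal_integral_norm_eq_lintegral_enorm hg]
        simp only [Real.norm_eq_abs, abs_of_nonneg (hg0 _)]
    _ ≤ ENNReal.ofReal c := ENNReal.ofReal_le_ofReal hc

theorem abs_trend_diff_le {m : ℝ → ℝ} {C : NNReal} (hm : LipschitzOnWith C m (Set.Icc 0 1))
    {T q : ℕ} {u : ℤ} (hu : (q : ℤ) ≤ u) (huT : u ≤ T) (hT : 0 < T) :
    |m ((u : ℝ) / T) - m (((u - q : ℤ) : ℝ) / T)| ≤ C * (q / T) := by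
  have hT' : (0 : ℝ) < T := by exact_mod_cast hT
  have hu' : (q : ℝ) ≤ u := by exact_mod_cast hu
  have huT' : (u : ℝ) ≤ T := by exact_mod_cast huT
  have hq0 : (0 : ℝ) ≤ q := by positivity
  have h1 : (u : ℝ) / T ∈ Set.Icc (0 : ℝ) 1 :=
    ⟨div_nonneg (hq0.trans hu') hT'.le, (div_le_one hT').mpr huT'⟩
  have h2 : ((u - q : ℤ) : ℝ) / T ∈ Set.Icc (0 : ℝ) 1 := by
    push_cast
    exact ⟨div_nonneg (by linarith) hT'.le, (div_le_one hT').mpr (by linarith)⟩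
  have h3 := hm.dist_le_mul _ h1 _ h2
  rw [Real.dist_eq, Real.dist_eq, ← sub_div] at h3
  push_cast at h3 ⊢
  rwa [sub_sub_cancel, abs_of_nonneg (div_nonneg hq0 hT'.le)] at h3

theorem eventually_div_le_one_div_sqrt {q : ℕ → ℕ}
    (hq : Tendsto (fun T : ℕ => (q T : ℝ) / √(T : ℝ)) atTop (𝓝 0)) :
    ∀ᶠ T : ℕ in atTop, 0 < T ∧ (q T : ℝ) / T ≤ 1 / √(T : ℝ) := by
  filter_upwards [eventually_gt_atTop 0, hq.eventually (gt_mem_nhds zero_lt_one)] with T hT h1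
  have hT' : (0 : ℝ) < T := by exact_mod_cast hT
  have hs : 0 < √(T : ℝ) := Real.sqrt_pos.mpr hT'
  refine ⟨hT, ?_⟩
  rw [div_lt_one hs] at h1
  rw [div_le_div_iff₀ hT' hs, one_mul]
  calc (q T : ℝ) * √(T : ℝ) ≤ √(T : ℝ) * √(T : ℝ) := by gcongr
    _ = T := Real.mul_self_sqrt hT'.le

/-- Sample second moments of `q_T`-th differences estimate the autocovariances of the differences
of the noise at the rate `T^{-1/2}`, uniformly in `q_T = o(√T)`: the differences of the trend are
of the order `q_T / T`. -/
theorem isBigOp_sum_diff_mul [IsProbabilityMeasure P] {ε : ℤ → Ω → ℝ} {γ : ℤ → ℝ} {K : ℝ}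
    (h : SampleMomentBound P ε γ K)
    {m : ℝ → ℝ} {C : NNReal} (hm : LipschitzOnWith C m (Set.Icc 0 1)) {q A : ℕ → ℕ} {L : ℕ}
    (hq : Tendsto (fun T : ℕ => (q T : ℝ) / √(T : ℝ)) atTop (𝓝 0)) (i j : ℕ)
    (hA1 : ∀ T, 1 ≤ A T) (hAi : ∀ T, q T + i ≤ A T) (hAj : ∀ T, q T + j ≤ A T)
    (hAL : ∀ T, A T ≤ q T + L) :
    IsBigOp P (fun T ω => (T : ℝ)⁻¹ * ∑ t ∈ Finset.Icc (A T : ℤ) (T : ℤ),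
        diff (q T) (obs m ε T ω) (t - i) * diff (q T) (obs m ε T ω) (t - j) -
      diffAutocov γ (q T) ((i : ℤ) - j)) (fun T => 1 / √(T : ℝ)) := by
  set I : ℕ → Finset ℤ := fun T => Finset.Icc (A T : ℤ) (T : ℤ) with hI
  set d : ℕ → ℤ → ℝ := fun T u => m ((u : ℝ) / T) - m (((u - q T : ℤ) : ℝ) / T) with hd
  set x : ℕ → ℤ → Ω → ℝ := fun T u ω => ε u ω - ε (u - q T) ω with hx
  have hev := eventually_div_le_one_div_sqrt hq
  have hsqrt_le : ∀ T : ℕ, 0 < T → 1 / √(T : ℝ) ≤ 1 := fun T hT => by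
    rw [div_le_one (Real.sqrt_pos.mpr (by exact_mod_cast hT)), Real.one_le_sqrt]
    exact_mod_cast hT
  have hcard : ∀ T, ((I T).card : ℝ) ≤ T ∧ (T : ℝ) - (I T).card ≤ q T + L := by
    intro T
    have h1 := hA1 T
    have h2 := hAL T
    have hc : (I T).card = T + 1 - A T := by
      simp only [hI, Int.card_Icc]; omega
    rw [hc]
    constructor
    · exact_mod_cast (by omega : T + 1 - A T ≤ T)
    · rw [sub_le_iff_le_add]
      exact_mod_cast (by omega : T ≤ q T + L + (T + 1 - A T))
  have hint : ∀ t, Integrable (ε t) P := fun t => (h.memLp t).integrable (by norm_num)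
  have hxmeas : ∀ T u, AEStronglyMeasurable (x T u) P := fun T u =>
    (hint _).1.sub (hint _).1
  have hK := h.nonneg
  -- `x T` and `d T` are the differences of the noise and of the trend; the noise part first
  have hnoise : IsBigOp P (fun T ω => (T : ℝ)⁻¹ * ∑ t ∈ I T, (x T (t - i) ω * x T (t - j) ω -
      diffAutocov γ (q T) ((i : ℤ) - j))) (fun T => 1 / √(T : ℝ)) := by
    refine IsBigOp.of_eLpNorm_le (K := 4 * K) eventually_one_div_sqrt_nat_pos (fun T => ?_) ?_
    · exact (Finset.aestronglyMeasurable_fun_sum _ fun t _ =>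
        ((hxmeas _ _).mul (hxmeas _ _)).sub aestronglyMeasurable_const).const_mul _
    · filter_upwards [hev] with T hT
      have hT' : (0 : ℝ) < T := by exact_mod_cast hT.1
      have h1 := h.eLpNorm_diff_le (I T) (q T) i j
      have h2 := eLpNorm_const_smul (T : ℝ)⁻¹ (fun ω => ∑ t ∈ I T, (x T (t - i) ω * x T (t - j) ω -
        diffAutocov γ (q T) ((i : ℤ) - j))) 1 P
      refine h2.le.trans ?_
      rw [← ofReal_norm, Real.norm_eq_abs, abs_of_pos (inv_pos.mpr hT')]
      refine (mul_le_mul_right h1 _).trans ?_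
      rw [← ENNReal.ofReal_mul (by positivity)]
      refine ENNReal.ofReal_le_ofReal ?_
      have h3 : √((I T).card : ℝ) ≤ √(T : ℝ) := Real.sqrt_le_sqrt (hcard T).1
      calc (T : ℝ)⁻¹ * (4 * K * √((I T).card : ℝ)) ≤ (T : ℝ)⁻¹ * (4 * K * √(T : ℝ)) := by gcongr
        _ = 4 * K * (√(T : ℝ) / T) := by ring
        _ = 4 * K * (1 / √(T : ℝ)) := by rw [Real.sqrt_div_self, one_div]
  -- the terms that involve the trend
  have htrend : IsBigOp P (fun T ω => (T : ℝ)⁻¹ * ∑ t ∈ I T, (d T (t - i) * d T (t - j) +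
      d T (t - i) * x T (t - j) ω + x T (t - i) ω * d T (t - j))) (fun T => 1 / √(T : ℝ)) := by
    refine IsBigOp.of_eLpNorm_le (K := (C : ℝ) ^ 2 + 4 * C * K) eventually_one_div_sqrt_nat_pos
      (fun T => ?_) ?_
    · exact (Finset.aestronglyMeasurable_fun_sum _ fun t _ => ((aestronglyMeasurable_const).add
        ((hxmeas _ _).const_mul _)).add ((hxmeas _ _).mul_const _)).const_mul _
    · filter_upwards [hev] with T hT
      have hT' : (0 : ℝ) < T := by exact_mod_cast hT.1
      set D : ℝ := C * (q T / T) with hD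
      have hD0 : 0 ≤ D := by positivity
      have hdle : ∀ t ∈ I T, |d T (t - i)| ≤ D ∧ |d T (t - j)| ≤ D := by
        intro t ht
        have hti := hAi T
        have htj := hAj T
        simp only [hI, Finset.mem_Icc] at ht
        exact ⟨abs_trend_diff_le hm (by omega) (by omega) hT.1,
          abs_trend_diff_le hm (by omega) (by omega) hT.1⟩
      set g : ℤ → Ω → ℝ := fun t ω => D ^ 2 + D * (|ε (t - i) ω| + |ε (t - i - q T) ω| +
        |ε (t - j) ω| + |ε (t - j - q T) ω|) with hg
      have hgint : ∀ t, Integrable (g t) P := fun t =>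
        (integrable_const _).add (((((hint _).abs.add (hint _).abs).add (hint _).abs).add
          (hint _).abs).const_mul _)
      have hgle : ∀ t, ∫ ω, g t ω ∂P ≤ D ^ 2 + D * (4 * K) := by
        intro t
        have h1 : Integrable (fun ω => |ε (t - i) ω| + |ε (t - i - q T) ω|) P :=
          (hint _).abs.add (hint _).abs
        have h2 : Integrable (fun ω => |ε (t - i) ω| + |ε (t - i - q T) ω| + |ε (t - j) ω|) P :=
          h1.add (hint _).abs
        have h3 : Integrable (fun ω => |ε (t - i) ω| + |ε (t - i - q T) ω| + |ε (t - j) ω| +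
          |ε (t - j - q T) ω|) P := h2.add (hint _).abs
        simp only [hg]
        rw [integral_add (integrable_const _) (h3.const_mul D), integral_const_mul,
          integral_add h2 (hint _).abs, integral_add h1 (hint _).abs,
          integral_add (hint _).abs (hint _).abs, integral_const, probReal_univ, one_smul]
        have := h.integral_abs_le
        gcongr
        linarith [this (t - i), this (t - i - q T), this (t - j), this (t - j - q T)]
      refine eLpNorm_one_le_of_abs_le (g := fun ω => (T : ℝ)⁻¹ * ∑ t ∈ I T, g t ω)
        ((integrable_finsetSum _ fun t _ => hgint t).const_mul _) (fun ω => ?_) ?_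
      · rw [abs_mul, abs_of_pos (inv_pos.mpr hT')]
        refine mul_le_mul_of_nonneg_left ((Finset.abs_sum_le_sum_abs _ _).trans
          (Finset.sum_le_sum fun t ht => ?_)) (inv_pos.mpr hT').le
        obtain ⟨h1, h2⟩ := hdle t ht
        have hxi : |x T (t - i) ω| ≤ |ε (t - i) ω| + |ε (t - i - q T) ω| := abs_sub _ _
        have hxj : |x T (t - j) ω| ≤ |ε (t - j) ω| + |ε (t - j - q T) ω| := abs_sub _ _
        calc |d T (t - i) * d T (t - j) + d T (t - i) * x T (t - j) ω + x T (t - i) ω * d T (t - j)|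
            ≤ |d T (t - i)| * |d T (t - j)| + |d T (t - i)| * |x T (t - j) ω| +
              |x T (t - i) ω| * |d T (t - j)| := by
              have := abs_add_three (d T (t - i) * d T (t - j)) (d T (t - i) * x T (t - j) ω)
                (x T (t - i) ω * d T (t - j))
              rwa [abs_mul, abs_mul, abs_mul] at this
          _ ≤ D * D + D * (|ε (t - j) ω| + |ε (t - j - q T) ω|) +
              (|ε (t - i) ω| + |ε (t - i - q T) ω|) * D := by gcongr
          _ = g t ω := by simp only [hg]; ring
      · rw [integral_const_mul, integral_finsetSum _ fun t _ => hgint t]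
        have h0 : 0 ≤ D ^ 2 + D * (4 * K) := by positivity
        have hDle : D ≤ C * (1 / √(T : ℝ)) := mul_le_mul_of_nonneg_left hT.2 C.2
        have hD1 : D ≤ C := hDle.trans (mul_le_of_le_one_right C.2 (hsqrt_le T hT.1))
        calc (T : ℝ)⁻¹ * ∑ t ∈ I T, ∫ ω, g t ω ∂P
            ≤ (T : ℝ)⁻¹ * ∑ _t ∈ I T, (D ^ 2 + D * (4 * K)) := by
              gcongr with t _
              exact hgle t
          _ = (T : ℝ)⁻¹ * ((I T).card * (D ^ 2 + D * (4 * K))) := by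
              rw [Finset.sum_const, nsmul_eq_mul]
          _ ≤ (T : ℝ)⁻¹ * (T * (D ^ 2 + D * (4 * K))) :=
              mul_le_mul_of_nonneg_left (mul_le_mul_of_nonneg_right (hcard T).1 h0)
                (inv_pos.mpr hT').le
          _ = D * (D + 4 * K) := by field_simp
          _ ≤ C * (1 / √(T : ℝ)) * (C + 4 * K) := by gcongr
          _ = ((C : ℝ) ^ 2 + 4 * C * K) * (1 / √(T : ℝ)) := by ring
  -- the correction for the number of summands
  have hedge : IsBigOp P (fun T (_ : Ω) => ((T : ℝ)⁻¹ * (I T).card - 1) *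
      diffAutocov γ (q T) ((i : ℤ) - j)) (fun T => 1 / √(T : ℝ)) := by
    refine IsBigOp.of_eventually_le (K := (1 + L) * (4 * K))
      (eventually_one_div_sqrt_nat_pos.mono fun _ hT => hT.le) ?_
    filter_upwards [hev] with T hT
    have hT' : (0 : ℝ) < T := by exact_mod_cast hT.1
    have h1 : |(T : ℝ)⁻¹ * (I T).card - 1| ≤ (1 + L) * (1 / √(T : ℝ)) := by
      have h2 : (T : ℝ)⁻¹ * (I T).card - 1 = -(((T : ℝ) - (I T).card) / T) := by
        field_simp; ring
      rw [h2, abs_neg, abs_of_nonneg (div_nonneg (by linarith [(hcard T).1]) hT'.le)]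
      have hLT : (L : ℝ) / T ≤ L * (1 / √(T : ℝ)) := by
        rw [div_eq_mul_one_div]
        refine mul_le_mul_of_nonneg_left (one_div_le_one_div_of_le
          (Real.sqrt_pos.mpr hT') ?_) (by positivity)
        rw [Real.sqrt_le_self_iff]
        exact Or.inr (by exact_mod_cast hT.1)
      calc ((T : ℝ) - (I T).card) / T ≤ (q T + L) / T := by gcongr; exact (hcard T).2
        _ = q T / T + L / T := add_div _ _ _
        _ ≤ 1 / √(T : ℝ) + L * (1 / √(T : ℝ)) := add_le_add hT.2 hLT
        _ = (1 + L) * (1 / √(T : ℝ)) := by ring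
    rw [Real.norm_eq_abs, abs_mul]
    calc |(T : ℝ)⁻¹ * (I T).card - 1| * |diffAutocov γ (q T) ((i : ℤ) - j)|
        ≤ (1 + L) * (1 / √(T : ℝ)) * (4 * K) := by
          gcongr
          exact h.abs_diffAutocov_le _ _
      _ = (1 + L) * (4 * K) * (1 / √(T : ℝ)) := by ring
  refine ((hnoise.add htrend).add hedge).congr' (.of_forall fun T => ?_)
  funext ω
  have hdiff : ∀ u, diff (q T) (obs m ε T ω) u = d T u + x T u ω := fun u => by
    simp only [diff, obs, hd, hx]; ring
  simp only [hdiff, ← mul_add, ← Finset.sum_add_distrib]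
  rw [show ∀ c : ℝ, ((T : ℝ)⁻¹ * (I T).card - 1) * c = (T : ℝ)⁻¹ * ∑ _t ∈ I T, c - c from
    fun c => by rw [Finset.sum_const, nsmul_eq_mul]; ring, ← add_sub_assoc, ← mul_add,
    ← Finset.sum_add_distrib]
  congr 2
  exact Finset.sum_congr rfl fun t _ => by ring

end SampleMoments

/-! ### Second moments of causal AR processes -/

section Causal

variable [IsProbabilityMeasure P] {p : ℕ} {a : Fin p → ℝ} {ν : ℝ} {ψ : ℕ → ℝ}
  {η ε : ℤ → Ω → ℝ} {e E : ℤ → Lp ℝ 2 P}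

/-- A common constant is available for all the moment bounds of a causal AR process. -/
theorem IsHilbertAR.exists_sampleMomentBound (h : IsHilbertAR a ν ψ e E)
    (hη : IsIIDNoise P ν η) (hη4 : ∀ t, MemLp (η t) 4 P) (hψ : Summable fun k => |ψ k|)
    (hsum : ∀ t : ℤ, ∀ᵐ ω ∂P, HasSum (fun k : ℕ => ψ k * η (t - (k : ℤ)) ω) (ε t ω))
    (hEε : ∀ t, E t =ᵐ[P] ε t) :
    ∃ K, SampleMomentBound P ε (maAutocov ν ψ) K := by
  set γ₀ := maAutocov ν ψ 0 with hγ₀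
  set κ := ∫ ω, η 0 ω ^ 4 ∂P with hκ
  have hmem : ∀ t, MemLp (ε t) 2 P := fun t => (Lp.memLp (E t)).ae_eq (hEε t)
  have hnorm : ∀ t, ‖E t‖ ^ 2 = γ₀ := fun t => by
    rw [← real_inner_self_eq_norm_sq, h.inner_process, sub_self]
  refine ⟨max (1 + γ₀) ((∑' k, |ψ k|) ^ 2 * √κ), hmem, fun t => ?_, fun l => ?_,
    fun I x y => ?_⟩
  · have hsq : ∫ ω, ε t ω ^ 2 ∂P = γ₀ := by
      simp only [sq]
      rw [integral_mul_eq_inner (hEε t) (hEε t), h.inner_process, sub_self]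
    refine le_trans ?_ (le_max_left _ _)
    calc ∫ ω, |ε t ω| ∂P ≤ ∫ ω, (1 + ε t ω ^ 2) ∂P := by
          refine integral_mono ((hmem t).integrable (by norm_num)).abs
            ((integrable_const _).add (hmem t).integrable_sq) fun ω => ?_
          simp only
          nlinarith [sq_abs (ε t ω), sq_nonneg (|ε t ω| - 1), abs_nonneg (ε t ω)]
      _ = 1 + γ₀ := by
          rw [integral_add (integrable_const _) (hmem t).integrable_sq, hsq]
          simp
  · refine le_trans ?_ (le_max_left _ _)
    have h1 := abs_real_inner_le_norm (E 0) (E l)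
    rw [h.inner_process, sub_zero] at h1
    nlinarith [sq_nonneg (‖E 0‖ - ‖E l‖), hnorm 0, hnorm l]
  · refine (eLpNorm_sum_mul_sub_le hη hη4 hψ hsum h I x y).trans (ENNReal.ofReal_le_ofReal ?_)
    have hκ0 : 0 ≤ κ := integral_nonneg fun ω => by positivity
    rw [Real.sqrt_mul hκ0, ← mul_assoc]
    exact mul_le_mul_of_nonneg_right (le_max_right _ _) (Real.sqrt_nonneg _)

theorem IsHilbertAR.integral_eq_zero (h : IsHilbertAR a ν ψ e E)
    (hη : IsIIDNoise P ν η) (heη : ∀ t, e t =ᵐ[P] η t) (hEε : ∀ t, E t =ᵐ[P] ε t) (t : ℤ) :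
    ∫ ω, ε t ω ∂P = 0 := by
  set o : Lp ℝ 2 P := (memLp_const (1 : ℝ)).toLp (fun _ => (1 : ℝ)) with ho
  have hoe : o =ᵐ[P] fun _ => (1 : ℝ) := MemLp.coeFn_toLp _
  have h1 : ∀ s, inner ℝ o (e s) = 0 := fun s => by
    rw [← integral_mul_eq_inner hoe (heη s)]
    simpa using hη.mean_zero s
  have h2 := integral_mul_eq_inner hoe (hEε t)
  simp only [one_mul] at h2
  have h3 : HasSum (fun k : ℕ => inner ℝ o (ψ k • e (t - k))) (inner ℝ o (E t)) :=
    (innerSL ℝ o).hasSum (h.hasSum t)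
  simp only [real_inner_smul_right, h1, mul_zero] at h3
  rw [h2, h3.unique hasSum_zero]

theorem IsHilbertAR.covariance_eq (h : IsHilbertAR a ν ψ e E)
    (hη : IsIIDNoise P ν η) (heη : ∀ t, e t =ᵐ[P] η t) (hEε : ∀ t, E t =ᵐ[P] ε t) (l : ℤ) :
    cov[ε 0, ε l; P] = maAutocov ν ψ l := by
  have hmem : ∀ t, MemLp (ε t) 2 P := fun t => (Lp.memLp (E t)).ae_eq (hEε t)
  rw [covariance_eq_sub (hmem 0) (hmem l), h.integral_eq_zero hη heη hEε, zero_mul, sub_zero]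
  simp only [Pi.mul_apply]
  rw [integral_mul_eq_inner (hEε 0) (hEε l), h.inner_process, sub_zero]

end Causal

/-! ### Consistency of sample autocovariances and of the innovation variance -/

section Autocov

variable [IsProbabilityMeasure P] {ε : ℤ → Ω → ℝ} {γ : ℤ → ℝ} {K : ℝ} {m : ℝ → ℝ} {C : NNReal}

theorem apply_natAbs (hγ : ∀ l, γ (-l) = γ l) (l : ℤ) : γ (l.natAbs : ℤ) = γ l := by
  rcases Int.natAbs_eq l with hl | hl
  · rw [← hl]
  · conv_rhs => rw [hl, hγ]

theorem diffAutocov_neg (hγ : ∀ l, γ (-l) = γ l) (r l : ℤ) :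
    diffAutocov γ r (-l) = diffAutocov γ r l := by
  simp only [diffAutocov, hγ]
  rw [← hγ (-l + r), ← hγ (-l - r), show -(-l + r) = l - r by ring,
    show -(-l - r) = l + r by ring]
  ring

/-- The sample autocovariances of the `q_T`-th differences are consistent for the limit of the
autocovariances of the differences, if the limit is attained at the rate `T^{-1/2}`. -/
theorem SampleMomentBound.rootConsistent_sampleAutocov (h : SampleMomentBound P ε γ K)
    (hm : LipschitzOnWith C m (Set.Icc 0 1)) {q : ℕ → ℕ}
    (hq : Tendsto (fun T : ℕ => (q T : ℝ) / √(T : ℝ)) atTop (𝓝 0)) (l : ℕ) {g B : ℝ}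
    (hg : ∀ᶠ T : ℕ in atTop, |diffAutocov γ (q T) l - g| ≤ B * (1 / √(T : ℝ))) :
    RootConsistent P (fun T ω => sampleAutocov (obs m ε T ω) T (q T) l) g := by
  have h1 := isBigOp_sum_diff_mul h hm (A := fun T => q T + l + 1) (L := l + 1) hq l 0
    (fun T => by omega) (fun T => by omega) (fun T => by omega) (fun T => by omega)
  simp only [Nat.cast_zero, sub_zero] at h1
  have h2 : IsBigOp P (fun T (_ : Ω) => diffAutocov γ (q T) l - g) (fun T => 1 / √(T : ℝ)) :=
    IsBigOp.of_eventually_le (eventually_one_div_sqrt_nat_pos.mono fun _ h => h.le) hg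
  have h3 : RootConsistent P (fun T ω => (T : ℝ)⁻¹ *
      ∑ t ∈ Finset.Icc ((q T + l + 1 : ℕ) : ℤ) (T : ℤ),
        diff (q T) (obs m ε T ω) (t - l) * diff (q T) (obs m ε T ω) t) g := by
    simpa only [RootConsistent, sub_add_sub_cancel] using h1.add h2
  -- the sum is normalized by `T - q` in the estimator
  have h4 : RootConsistent P (fun T (_ : Ω) => ((T : ℝ) - q T) / T) 1 := by
    refine IsBigOp.of_eventually_le (K := 1)
      (eventually_one_div_sqrt_nat_pos.mono fun _ h => h.le) ?_
    filter_upwards [eventually_div_le_one_div_sqrt hq] with T hT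
    have hT' : (T : ℝ) ≠ 0 := by exact_mod_cast hT.1.ne'
    rw [sub_div, div_self hT', sub_sub_cancel_left, norm_neg, Real.norm_of_nonneg
      (by positivity), one_mul]
    exact hT.2
  have h5 := (h4.inv one_ne_zero).mul h3
  rw [inv_one, one_mul] at h5
  refine h5.congr' ?_
  filter_upwards [eventually_gt_atTop 0] with T hT
  have hT' : (T : ℝ) ≠ 0 := by positivity
  funext ω
  rw [sampleAutocov, inv_div, ← mul_assoc, div_mul_eq_mul_div, mul_inv_cancel₀ hT', one_div]
  push_cast
  congr 1
  exact Finset.sum_congr rfl fun t _ => mul_comm _ _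

theorem SampleMomentBound.rootConsistent_sampleAutocov_fixed (h : SampleMomentBound P ε γ K)
    (hm : LipschitzOnWith C m (Set.Icc 0 1)) (r l : ℕ) :
    RootConsistent P (fun T ω => sampleAutocov (obs m ε T ω) T r l) (diffAutocov γ r l) := by
  refine h.rootConsistent_sampleAutocov hm (q := fun _ => r) (B := 0) ?_ l
    (.of_forall fun T => by simp)
  simpa [div_eq_mul_inv, one_div] using tendsto_one_div_sqrt_nat.const_mul (r : ℝ)

/-- If `q_T` grows faster than `log T`, a geometric rate in `q_T` is faster than `T^{-1/2}`. -/
theorem eventually_inv_pow_le {q : ℕ → ℕ} {θ : ℝ} (hθ : 1 < θ)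
    (hq : Tendsto (fun T : ℕ => (q T : ℝ) / Real.log (T : ℝ)) atTop atTop) :
    ∀ᶠ T : ℕ in atTop, θ⁻¹ ^ q T ≤ 1 / √(T : ℝ) := by
  have hlog : 0 < Real.log θ := Real.log_pos hθ
  filter_upwards [hq.eventually_ge_atTop (Real.log θ)⁻¹, eventually_gt_atTop 1] with T h1 hT
  have hT1 : (1 : ℝ) < T := by exact_mod_cast hT
  have hT0 : (0 : ℝ) < T := by linarith
  rw [le_div_iff₀ (Real.log_pos hT1), inv_mul_le_iff₀ hlog, mul_comm, ← Real.log_pow,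
    Real.log_le_log_iff hT0 (by positivity)] at h1
  rw [inv_pow, ← one_div]
  refine one_div_le_one_div_of_le (Real.sqrt_pos.mpr hT0) (le_trans ?_ h1)
  rw [Real.sqrt_le_self_iff]
  exact Or.inr hT1.le

/-- For geometrically decaying autocovariances, the `q_T`-th differences of a process behave at
fixed lags like differences of independent copies, of autocovariance `2 γ`. -/
theorem SampleMomentBound.rootConsistent_sampleAutocov_growing (h : SampleMomentBound P ε γ K)
    (hm : LipschitzOnWith C m (Set.Icc 0 1)) {θ B : ℝ} (hθ : 1 < θ)
    (hγ : ∀ l, γ (-l) = γ l) (hdecay : ∀ l : ℕ, |γ l| ≤ B * θ⁻¹ ^ l) {q : ℕ → ℕ}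
    (hqt : Tendsto q atTop atTop)
    (hq_log : Tendsto (fun T : ℕ => (q T : ℝ) / Real.log (T : ℝ)) atTop atTop)
    (hq : Tendsto (fun T : ℕ => (q T : ℝ) / √(T : ℝ)) atTop (𝓝 0)) (l : ℕ) :
    RootConsistent P (fun T ω => sampleAutocov (obs m ε T ω) T (q T) l) (2 * γ l) := by
  have hB : 0 ≤ B := by simpa using (abs_nonneg _).trans (hdecay 0)
  have hθ0 : 0 < θ := by linarith
  refine h.rootConsistent_sampleAutocov hm hq l (B := B + B * θ ^ l) ?_
  filter_upwards [eventually_inv_pow_le hθ hq_log, hqt.eventually_ge_atTop l] with T h1 h2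
  have h3 : |γ (l + q T)| ≤ B * θ⁻¹ ^ q T := by
    have := hdecay (l + q T)
    push_cast at this
    refine this.trans (mul_le_mul_of_nonneg_left ?_ hB)
    exact pow_le_pow_of_le_one (by positivity) (inv_le_one_of_one_le₀ hθ.le) (by omega)
  have h4 : |γ (l - q T)| ≤ B * θ ^ l * θ⁻¹ ^ q T := by
    have h5 := hdecay (q T - l)
    rw [← hγ, neg_sub, ← Nat.cast_sub h2]
    refine h5.trans_eq ?_
    have h6 : θ⁻¹ ^ q T = θ⁻¹ ^ (q T - l) * θ⁻¹ ^ l := by rw [← pow_add, Nat.sub_add_cancel h2]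
    rw [h6, inv_pow θ l]
    field_simp
  have h7 : |diffAutocov γ (q T) l - 2 * γ l| ≤ |γ (l + q T)| + |γ (l - q T)| := by
    rw [show diffAutocov γ (q T) l - 2 * γ l = -γ (l + q T) - γ (l - q T) by
      rw [diffAutocov]; ring]
    refine (abs_sub _ _).trans_eq ?_
    rw [abs_neg]
  calc |diffAutocov γ (q T) l - 2 * γ l| ≤ (B + B * θ ^ l) * θ⁻¹ ^ q T := by linarith
    _ ≤ (B + B * θ ^ l) * (1 / √(T : ℝ)) := by gcongr

/-- Consistency of the innovation variance estimator, as a quadratic polynomial in the plugged-in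
AR parameters whose coefficients are sample second moments. -/
theorem SampleMomentBound.rootConsistent_innovVarEst (h : SampleMomentBound P ε γ K)
    (hm : LipschitzOnWith C m (Set.Icc 0 1)) {p s : ℕ} (hs : p + 1 ≤ s)
    {b : ℕ → Ω → Fin p → ℝ} {a : Fin p → ℝ} (hb : RootConsistent P b a) {v : ℝ}
    (hv : diffAutocov γ 1 0 - 2 * ∑ j : Fin p, a j * diffAutocov γ 1 ((j : ℤ) + 1) +
        ∑ j : Fin p, ∑ k : Fin p, a j * a k * diffAutocov γ 1 ((j : ℤ) - k) = 2 * v) :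
    RootConsistent P (fun T ω => innovVarEst s (b T ω) (obs m ε T ω) T) v := by
  set S : ℕ → ℕ → ℕ → Ω → ℝ := fun i j T ω => (T : ℝ)⁻¹ * ∑ t ∈ Finset.Icc (s : ℤ) (T : ℤ),
    diff 1 (obs m ε T ω) (t - i) * diff 1 (obs m ε T ω) (t - j) with hSdef
  have hS : ∀ i j, i ≤ p → j ≤ p → RootConsistent P (S i j) (diffAutocov γ 1 ((i : ℤ) - j)) := by
    intro i j hi hj
    exact isBigOp_sum_diff_mul h hm (q := fun _ => 1) (A := fun _ => s) (L := s)
      (by simpa using tendsto_one_div_sqrt_nat) i j (fun T => by omega) (fun T => by omega)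
      (fun T => by omega) (fun T => by omega)
  have h0 := hS 0 0 (Nat.zero_le _) (Nat.zero_le _)
  have h1 : ∀ j : Fin p, RootConsistent P (S ((j : ℕ) + 1) 0)
      (diffAutocov γ 1 ((j : ℤ) + 1)) := fun j => by
    simpa using hS ((j : ℕ) + 1) 0 (by omega) (Nat.zero_le _)
  have h2 : ∀ j k : Fin p, RootConsistent P (S ((j : ℕ) + 1) ((k : ℕ) + 1))
      (diffAutocov γ 1 ((j : ℤ) - k)) := fun j k => by
    simpa using hS ((j : ℕ) + 1) ((k : ℕ) + 1) (by omega) (by omega)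
  have hfin := ((h0.sub ((RootConsistent.sum Finset.univ fun j _ =>
    (hb.apply j).mul (h1 j)).const_mul 2)).add (RootConsistent.sum Finset.univ fun j _ =>
      RootConsistent.sum Finset.univ fun k _ =>
        ((hb.apply j).mul (hb.apply k)).mul (h2 j k))).const_mul 2⁻¹
  rw [Nat.cast_zero, sub_self, hv, inv_mul_cancel_left₀ two_ne_zero] at hfin
  refine hfin.congr' (.of_forall fun T => ?_)
  funext ω
  set y := obs m ε T ω with hy
  have hres : ∀ t, residual (b T ω) y t ^ 2 = diff 1 y t * diff 1 y t -
      2 * ∑ j : Fin p, b T ω j * (diff 1 y (t - ((j : ℤ) + 1)) * diff 1 y t) +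
      ∑ j : Fin p, ∑ k : Fin p, b T ω j * b T ω k *
        (diff 1 y (t - ((j : ℤ) + 1)) * diff 1 y (t - ((k : ℤ) + 1))) := by
    intro t
    have hsq : (∑ j : Fin p, b T ω j * diff 1 y (t - ((j : ℤ) + 1))) ^ 2 =
        ∑ j : Fin p, ∑ k : Fin p, b T ω j * b T ω k *
          (diff 1 y (t - ((j : ℤ) + 1)) * diff 1 y (t - ((k : ℤ) + 1))) := by
      rw [sq, Finset.sum_mul_sum]
      exact Finset.sum_congr rfl fun j _ => Finset.sum_congr rfl fun k _ => by ring
    have hlin : ∑ j : Fin p, b T ω j * (diff 1 y (t - ((j : ℤ) + 1)) * diff 1 y t) =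
        (∑ j : Fin p, b T ω j * diff 1 y (t - ((j : ℤ) + 1))) * diff 1 y t := by
      rw [Finset.sum_mul]
      exact Finset.sum_congr rfl fun j _ => by ring
    rw [← hsq, hlin, residual]
    ring
  have hlin : ∀ F : Fin p → ℤ → ℝ, ∑ t ∈ Finset.Icc (s : ℤ) (T : ℤ),
      ∑ j : Fin p, b T ω j * F j t =
      ∑ j : Fin p, b T ω j * ∑ t ∈ Finset.Icc (s : ℤ) (T : ℤ), F j t := fun F => by
    rw [Finset.sum_comm]
    exact Finset.sum_congr rfl fun j _ => (Finset.mul_sum _ _ _).symm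
  have hquad : ∀ F : Fin p → Fin p → ℤ → ℝ, ∑ t ∈ Finset.Icc (s : ℤ) (T : ℤ),
      ∑ j : Fin p, ∑ k : Fin p, b T ω j * b T ω k * F j k t =
      ∑ j : Fin p, ∑ k : Fin p, b T ω j * b T ω k *
        ∑ t ∈ Finset.Icc (s : ℤ) (T : ℤ), F j k t := fun F => by
    rw [Finset.sum_comm]
    refine Finset.sum_congr rfl fun j _ => ?_
    rw [Finset.sum_comm]
    exact Finset.sum_congr rfl fun k _ => (Finset.mul_sum _ _ _).symm
  rw [innovVarEst, Finset.sum_congr rfl fun t _ => hres t, Finset.sum_add_distrib,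
    Finset.sum_sub_distrib, ← Finset.mul_sum, hlin, hquad]
  simp only [hSdef, Nat.cast_add, Nat.cast_one, Nat.cast_zero, sub_zero, mul_left_comm _ (T : ℝ)⁻¹,
    ← Finset.mul_sum, mul_inv]
  ring

end Autocov

/-! ### Plug-in impulse responses -/

section Estimators

variable {p : ℕ} {a : Fin p → ℝ} {ν : ℝ}

theorem RootConsistent.maCoeff {b : ℕ → Ω → Fin p → ℝ} (hb : RootConsistent P b a) (n : ℕ) :
    RootConsistent P (fun T ω => DiffLRV.maCoeff (b T ω) n) (DiffLRV.maCoeff a n) := by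
  induction n using Nat.strong_induction_on with
  | _ n ih =>
    cases n with
    | zero => simpa only [DiffLRV.maCoeff] using RootConsistent.const (P := P) (1 : ℝ)
    | succ k =>
      simp only [DiffLRV.maCoeff]
      refine RootConsistent.sum _ fun j _ => ?_
      split_ifs
      · exact (hb.apply j).mul (ih _ (by omega))
      · exact RootConsistent.const _

theorem RootConsistent.maVector {b : ℕ → Ω → Fin p → ℝ} (hb : RootConsistent P b a) (r : ℕ)
    (i : Fin p) : RootConsistent P (fun T ω => DiffLRV.maVector (b T ω) r i)
      (DiffLRV.maVector a r i) := by
  simp only [DiffLRV.maVector]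
  split_ifs
  · exact hb.maCoeff _
  · exact RootConsistent.const _

theorem maVector_eq_zeroExtend (a : Fin p → ℝ) (r : ℕ) (i : Fin p) :
    maVector a r i = zeroExtend (maCoeff a) ((r : ℤ) - ((i : ℤ) + 1)) := by
  rw [maVector]
  split_ifs with h
  · rw [show (r : ℤ) - ((i : ℤ) + 1) = ((r - ((i : ℕ) + 1) : ℕ) : ℤ) by omega,
      zeroExtend_natCast]
  · rw [zeroExtend_of_neg _ (by omega)]

end Estimators

end DiffLRV

/-! ### Consistency of the estimators -/

theorem proposition4p1 {Ω : Type*} [MeasurableSpace Ω] (P : Measure Ω) [IsProbabilityMeasure P]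
    (p : ℕ) (a : Fin p → ℝ) (ν : ℝ) (hν : 0 < ν)
    (η ε : ℤ → Ω → ℝ)
    (hη : DiffLRV.IsIIDNoise P ν η)
    (hη4 : ∀ t, MemLp (η t) 4 P)
    (hε : DiffLRV.IsCausalAR P a η ε)
    (m : ℝ → ℝ) (hm : ∃ C, LipschitzOnWith C m (Set.Icc 0 1))
    (q : ℕ → ℕ) (hq : Tendsto q atTop atTop)
    (hq_log : Tendsto (fun T : ℕ => (q T : ℝ) / Real.log (T : ℝ)) atTop atTop)
    (hq_sqrt : Tendsto (fun T : ℕ => (q T : ℝ) / √(T : ℝ)) atTop (𝓝 0))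
    (R : ℕ) (hR : 1 ≤ R)
    -- first time point in the sums of squared residuals
    (s : ℕ) (hs : s = p + 1 ∨ s = p + 2) :
    DiffLRV.IsBigOp P
        (fun T ω => DiffLRV.pilotEst p (DiffLRV.obs m ε T ω) T (q T) - a)
        (fun T => 1 / √(T : ℝ)) ∧
      DiffLRV.IsBigOp P
        (fun T ω => DiffLRV.refinedEst p s (DiffLRV.obs m ε T ω) T (q T) R - a)
        (fun T => 1 / √(T : ℝ)) ∧
      Summable (fun l : ℤ => cov[ε 0, ε l; P]) ∧
      DiffLRV.IsBigOp P
        (fun T ω => DiffLRV.lrvEst p s (DiffLRV.obs m ε T ω) T (q T) R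
          - DiffLRV.longRunVar P ε)
        (fun T => 1 / √(T : ℝ)) := by
  obtain ⟨ψ, hψ, hsum⟩ := hε.causal
  obtain ⟨C, hm⟩ := hm
  obtain ⟨e, E, h, heη, hEε⟩ := DiffLRV.exists_isHilbertAR hη hη4 hε hψ hsum
  obtain ⟨K, hK⟩ := h.exists_sampleMomentBound hη hη4 hψ hsum hEε
  have hrec := h.recursion hν
  have hψa := DiffLRV.zeroExtend_eq_maCoeff hrec
  obtain ⟨θ, hθ, B, -, hB⟩ := DiffLRV.exists_maCoeff_le_geometric a (by rwa [← hψa])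
  rw [← hψa] at hB
  have hs' : p + 1 ≤ s := by omega
  have hpilot : DiffLRV.RootConsistent P
      (fun T ω => DiffLRV.pilotEst p (DiffLRV.obs m ε T ω) T (q T)) a := by
    have hcons := hK.rootConsistent_sampleAutocov_growing hm hθ h.maAutocov_neg
      (DiffLRV.abs_maAutocov_le ν hψ hθ hB) hq hq_log hq_sqrt
    refine DiffLRV.RootConsistent.inv_mulVec
      (A₀ := (2 : ℝ) •
        Matrix.of fun i j : Fin p => DiffLRV.maAutocov ν ψ ((i : ℤ) - j))
      (v₀ := fun i : Fin p => 2 * DiffLRV.maAutocov ν ψ ((i : ℤ) + 1)) (fun i j => ?_)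
      (fun i => ?_) ?_ ?_
    · have h1 := hcons ((i : ℤ) - (j : ℤ)).natAbs
      rwa [DiffLRV.apply_natAbs h.maAutocov_neg] at h1
    · have h1 := hcons ((i : ℕ) + 1)
      rwa [Nat.cast_add, Nat.cast_one] at h1
    · rw [Matrix.det_smul]
      exact mul_ne_zero (by positivity) (h.det_autocov_ne_zero hν)
    · funext i
      rw [Matrix.smul_mulVec, Pi.smul_apply, smul_eq_mul, ← h.yule_walker i]
      rfl
  have hrefined : DiffLRV.RootConsistent P
      (fun T ω => DiffLRV.refinedEst p s (DiffLRV.obs m ε T ω) T (q T) R) a := by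
    have hν2 := hK.rootConsistent_innovVarEst hm hs' hpilot h.residual_variance
    have hsecond : ∀ r ∈ Finset.Icc 1 R, DiffLRV.RootConsistent P
        (fun T ω => DiffLRV.secondStageEst p s (DiffLRV.obs m ε T ω) T (q T) r) a := by
      intro r hr
      have hr1 : 1 ≤ r := (Finset.mem_Icc.mp hr).1
      have hcons := hK.rootConsistent_sampleAutocov_fixed hm r
      refine DiffLRV.RootConsistent.inv_mulVec
        (A₀ := Matrix.of fun i j : Fin p =>
          DiffLRV.diffAutocov (DiffLRV.maAutocov ν ψ) r ((i : ℤ) - j))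
        (v₀ := fun i : Fin p => DiffLRV.diffAutocov (DiffLRV.maAutocov ν ψ) r ((i : ℤ) + 1) +
          ν ^ 2 * DiffLRV.maVector a r i) (fun i j => ?_) (fun i => ?_)
        (h.det_diffAutocov_ne_zero hν hr1) ?_
      · have h1 := hcons ((i : ℤ) - (j : ℤ)).natAbs
        rwa [DiffLRV.apply_natAbs (DiffLRV.diffAutocov_neg h.maAutocov_neg r)] at h1
      · have h1 := hcons ((i : ℕ) + 1)
        rw [Nat.cast_add, Nat.cast_one] at h1
        exact h1.add (hν2.mul (hpilot.maVector r i))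
      · funext i
        rw [DiffLRV.maVector_eq_zeroExtend, ← hψa]
        exact h.yule_walker_diff r i
    refine DiffLRV.RootConsistent.pi fun i => ?_
    have hR0 : (R : ℝ) ≠ 0 := by positivity
    have h1 := (DiffLRV.RootConsistent.sum (Finset.Icc 1 R)
      fun r hr => (hsecond r hr).apply i).const_mul (R : ℝ)⁻¹
    rw [Finset.sum_const, Nat.card_Icc, Nat.add_sub_cancel, nsmul_eq_mul,
      inv_mul_cancel_left₀ hR0] at h1
    simpa only [DiffLRV.refinedEst, Pi.smul_apply, Finset.sum_apply, smul_eq_mul] using h1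
  have hcov := h.covariance_eq hη heη hEε
  have hγsum := DiffLRV.hasSum_maAutocov ν hψ
  have hone := DiffLRV.tsum_mul_one_sub_sum (summable_abs_iff.mp hψ) hrec
  have hne : 1 - ∑ j, a j ≠ 0 := right_ne_zero_of_mul_eq_one hone
  refine ⟨hpilot, hrefined, ?_, ?_⟩
  · simp only [hcov]
    exact hγsum.summable
  · have hlrv : DiffLRV.longRunVar P ε = ν ^ 2 / (1 - ∑ j, a j) ^ 2 := by
      rw [DiffLRV.longRunVar]
      simp only [hcov]
      rw [hγsum.tsum_eq, eq_div_iff (pow_ne_zero 2 hne), mul_assoc, ← mul_pow, hone, one_pow,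
        mul_one]
    have hν2 := hK.rootConsistent_innovVarEst hm hs' hrefined h.residual_variance
    have hden := ((DiffLRV.RootConsistent.const (P := P) (1 : ℝ)).sub
      (DiffLRV.RootConsistent.sum Finset.univ fun j _ => hrefined.apply j)).pow 2
    have hfin := hν2.mul (hden.inv (pow_ne_zero 2 hne))
    simp only [← div_eq_mul_inv] at hfin
    rw [hlrv]
    exact hfin
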